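/- **Theorem (Chen, 2010).** Let $-\infty\le -M<N\le\infty$, $E=(-M,N)$, and let $L=a(x)\frac{d^2}{dx^2}+b(x)\frac{d}{dx}$ with real functions $a,b$ on $E$ such that $a>0$ and $b/a$, $1/a$ are locally integrable on $E$ (for instance, $a,b$ continuous). Fix $\theta\in E$ and put $C(x)=\int_\theta^x \frac ba$. Define on $E$ the speed measure $\mu$, the scale measure $\hat\nu$, and the measure $\nu$, by $$\frac{d\mu}{dx}=\frac{e^{C}}{a},\qquad \frac{d\hat\nu}{dx}=e^{-C},\qquad \frac{d\nu}{dx}=e^{C},$$ and write $\mu(\alpha,\beta)=\mu((\alpha,\beta))$, $\hat\nu(\alpha,\beta)=\hat\nu((\alpha,\beta))$. For $\#\in\{\mathrm{NN},\mathrm{DD},\mathrm{DN},\mathrm{ND}\}$ (the first letter refers to $-M$, the second to $N$; D is Dirichlet, N is Neumann) let the leading eigenvalue $\lambda^{\#}\in[0,\infty]$ be the optimal constant in the Poincaré inequality $$\lambda^{\#}\int_E f^2\,d\mu\le\int_E f'^2\,d\nu ,$$ that is, the supremum of all $\lambda\in[0,\infty]$ for which it holds, with both sides in $[0,\infty]$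 and $0\cdot\infty=0$, for every locally absolutely continuous $f:E\to\mathbb R$ such that $\lim_{x\to -M}f(x)=0$ if the boundary at $-M$ is Dirichlet, $\lim_{x\to N}f(x)=0$ if the boundary at $N$ is Dirichlet, and, in the case NN, $f\in L^1(\mu)$ and $\mu(f)=\int_E f\,d\mu=0$. In the case NN assume that $\mu(E)<\infty$. Let $\kappa^{\#}\in[0,\infty]$ be given by $$\begin{aligned} (\kappa^{\mathrm{NN}})^{-1}&=\inf_{x<y}\big\{\mu(-M,x)^{-1}+\mu(y,N)^{-1}\big\}\,\hat\nu(x,y)^{-1},\\ (\kappa^{\mathrm{DD}})^{-1}&=\inf_{x\le y}\big\{\hat\nu(-M,x)^{-1}+\hat\nu(y,N)^{-1}\big\}\,\mu(x,y)^{-1},\\ \kappa^{\mathrm{DN}}&=\sup_{x\in E}\hat\nu(-M,x)\,\mu(x,N),\\ \kappa^{\mathrm{ND}}&=\sup_{x\in E}\mu(-M,x)\,\hat\nu(x,N), \end{aligned}$$ where $x,y$ range over $E$ and $0^{-1}=\infty$, $\infty^{-1}=0$ (in particular $0\cdot\infty=0$ in the second line, where both factors may degenerate if $x=y$). Then in each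 of the four cases $$(4\kappa^{\#})^{-1}\le\lambda^{\#}\le(\kappa^{\#})^{-1}.$$ In particular, $\lambda^{\#}>0$ if and only if $\kappa^{\#}<\infty$. -/

import Mathlib

open MeasureTheory Set Filter
open scoped ENNReal Topology

noncomputable section

namespace EllipticLine

/-- Type of a boundary point: `dirichlet` (absorbing, code D) or `neumann` (reflecting, code N). -/
inductive Boundary
  | dirichlet
  | neumann

/-- The data of an operator `L = a d²/dx² + b d/dx` on the open interval `(lo, hi)`, where
`lo = -M` and `hi = N` may be infinite, together with a reference point `θ`. -/
structure Operator where
  lo : EReal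
  hi : EReal
  a : ℝ → ℝ
  b : ℝ → ℝ
  θ : ℝ

/-- The open interval `(p, q)` of real numbers, with endpoints in `[-∞, ∞]`. -/
def interval (p q : EReal) : Set ℝ := {x : ℝ | p < (x : EReal) ∧ (x : EReal) < q}

namespace Operator

variable (L : Operator)

/-- The state space `E = (-M, N)`. -/
def E : Set ℝ := interval L.lo L.hi

/-- Standing assumptions: the interval is nonempty and contains the reference point, `a > 0` on it,
and the coefficients `b / a` and `1 / a` are locally integrable on it. -/
structure IsElliptic : Prop where
  lt : L.lo < L.hi
  ref_mem : L.θ ∈ L.E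
  a_pos : ∀ x ∈ L.E, 0 < L.a x
  locInt_drift : LocallyIntegrableOn (fun x => L.b x / L.a x) L.E volume
  locInt_inv : LocallyIntegrableOn (fun x => 1 / L.a x) L.E volume

/-- `C(x) = ∫_θ^x b / a`. -/
def C (x : ℝ) : ℝ := ∫ t in L.θ..x, L.b t / L.a t

/-- The speed measure `dμ = (e^C / a) dx` on `(-M, N)`. -/
def speed : Measure ℝ :=
  (volume.restrict L.E).withDensity fun x => ENNReal.ofReal (Real.exp (L.C x) / L.a x)

/-- The scale measure `dν̂ = e^{-C} dx` on `(-M, N)`. -/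
def scale : Measure ℝ :=
  (volume.restrict L.E).withDensity fun x => ENNReal.ofReal (Real.exp (-L.C x))

/-- The Dirichlet energy `‖f'‖²_{L²(ν)} = ∫_{-M}^N f'(x)² e^{C(x)} dx`, with values in `[0, ∞]`. -/
def energy (f : ℝ → ℝ) : ℝ≥0∞ :=
  ∫⁻ x in L.E, ENNReal.ofReal (deriv f x ^ 2 * Real.exp (L.C x))

/-- `‖f‖²_{L²(μ)}`, with values in `[0, ∞]`. -/
def normSq (f : ℝ → ℝ) : ℝ≥0∞ := ∫⁻ x, ENNReal.ofReal (f x ^ 2) ∂L.speed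

/-- `f` is absolutely continuous on every compact subinterval of `(-M, N)`. -/
def LocallyAC (f : ℝ → ℝ) : Prop :=
  ∀ x ∈ L.E, ∀ y ∈ L.E, AbsolutelyContinuousOnInterval f x y

/-- `f(-M) = 0`, as a limit from inside the interval. -/
def VanishesAtLo (f : ℝ → ℝ) : Prop :=
  Tendsto f (comap Real.toEReal (𝓝[>] L.lo)) (𝓝 0)

/-- `f(N) = 0`, as a limit from inside the interval. -/
def VanishesAtHi (f : ℝ → ℝ) : Prop :=
  Tendsto f (comap Real.toEReal (𝓝[<] L.hi)) (𝓝 0)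

/-- `f` is orthogonal to the constants: `μ(f) = 0`. -/
def MeanZero (f : ℝ → ℝ) : Prop := Integrable f L.speed ∧ ∫ x, f x ∂L.speed = 0

/-- The test functions for the boundary condition `l` at `-M` and `r` at `N`: a Dirichlet boundary
forces the function to vanish there, a Neumann boundary (which is natural for the energy) imposes
nothing, and with two Neumann boundaries the constants are factored out by `μ(f) = 0`. -/
def Admissible : Boundary → Boundary → (ℝ → ℝ) → Prop
  | .neumann, .neumann, f => L.LocallyAC f ∧ L.MeanZero f
  | .dirichlet, .dirichlet, f => L.LocallyAC f ∧ L.VanishesAtLo f ∧ L.VanishesAtHi f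
  | .dirichlet, .neumann, f => L.LocallyAC f ∧ L.VanishesAtLo f
  | .neumann, .dirichlet, f => L.LocallyAC f ∧ L.VanishesAtHi f

/-- The leading eigenvalue `λ^#` for the boundary condition `l` at `-M` and `r` at `N`: the optimal
constant in the Poincaré inequality `λ ‖f‖²_{L²(μ)} ≤ ‖f'‖²_{L²(ν)}`. -/
def leadingEigenvalue (l r : Boundary) : ℝ≥0∞ :=
  sSup {lam : ℝ≥0∞ | ∀ f : ℝ → ℝ, L.Admissible l r f → lam * L.normSq f ≤ L.energy f}

/-- `κ^NN`. -/
def kappaNN : ℝ≥0∞ :=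
  (⨅ (x ∈ L.E) (y ∈ L.E) (_ : x < y),
    ((L.speed (interval L.lo x))⁻¹ + (L.speed (interval y L.hi))⁻¹)
      * (L.scale (interval x y))⁻¹)⁻¹

/-- `κ^DD`. -/
def kappaDD : ℝ≥0∞ :=
  (⨅ (x ∈ L.E) (y ∈ L.E) (_ : x ≤ y),
    ((L.scale (interval L.lo x))⁻¹ + (L.scale (interval y L.hi))⁻¹)
      * (L.speed (interval x y))⁻¹)⁻¹

/-- `κ^DN`. -/
def kappaDN : ℝ≥0∞ :=
  ⨆ x ∈ L.E, L.scale (interval L.lo x) * L.speed (interval x L.hi)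

/-- `κ^ND`. -/
def kappaND : ℝ≥0∞ :=
  ⨆ x ∈ L.E, L.speed (interval L.lo x) * L.scale (interval x L.hi)

/-- The constant `κ^#` for the boundary condition `l` at `-M` and `r` at `N`. -/
def kappa : Boundary → Boundary → ℝ≥0∞
  | .neumann, .neumann => L.kappaNN
  | .dirichlet, .dirichlet => L.kappaDD
  | .dirichlet, .neumann => L.kappaDN
  | .neumann, .dirichlet => L.kappaND

end Operator

end EllipticLine

end

/-! ### Muckenhoupt's form of Hardy's inequality -/

namespace EllipticLine

/-! The lower bounds on the eigenvalues come from Hardy's inequality, the upper bounds from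
piecewise harmonic test functions.

Lower bounds. Where `f` vanishes at one end of an interval, `|f x|` is at most the integral of
`|f'|` from that end. Writing `|f'| dt = h dν̂`, the energy is `∫ h² dν̂`, and
`lintegral_sq_lintegral_le` bounds `∫ f² dμ` by `4B` times it, where `B` is the supremum of the
scale mass on the side of the vanishing end times the speed mass on the other side. The 4 is `2 *
2`: the bound `∫ S^{-1/2} dS ≤ 2 S^{1/2}` is used once for `ν̂` and once for `μ`. This settles DN
and ND at once.

For DD and NN the interval is cut. By `forall_le_or_forall_le`, if `κ < ∞`, then at every `θ` the
Hardy constant of the left piece or that of the right piece is at most `κ`: two failures would add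
up to a violation of the definition of `κ`. At the supremum `c` of the points with a good left piece
both pieces are good (`exists_split`), and the two Hardy inequalities add up. In DD, `f` vanishes at
the outer ends. In NN, `f - f c` vanishes at the cut, and subtracting a constant from a function of
mean zero only increases its second moment; if `c` is an end of `E`, the interval is exhausted
instead.

Upper bounds. A function rising from 0 to 1 along the scale function between `z` and `x` has energy
`1 / ν̂(z,x)`, and its norm is at least the mass of the plateau. One such slope gives DN and ND, two
give DD, and one slope minus its mean gives NN. -/

theorem ae_ne_zero_of_measure_lt_le {α : Type*} [MeasurableSpace α] {m : Measure α}
    {Φ : α → ℝ≥0∞} (h : ∀ v, m {t | Φ t < v} ≤ v) : ∀ᵐ t ∂m, Φ t ≠ 0 := by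
  have hnull : m {t | Φ t = 0} = 0 := by
    refine le_antisymm (ENNReal.le_of_forall_pos_le_add fun ε hε _ => ?_) zero_le
    rw [zero_add]
    refine le_trans (measure_mono ?_) (h ε)
    intro t ht
    simp only [mem_ofPred_eq] at ht ⊢
    rw [ht]
    exact_mod_cast hε
  rw [ae_iff]
  simpa using hnull

/-- If `Φ` is distributed under `m` no more densely near `0` than Lebesgue measure, then
`∫ Φ^{-1/2} dm` is at most `∫_0^{m(univ)} u^{-1/2} du`. -/
theorem lintegral_rpow_neg_half_le {α : Type*} [MeasurableSpace α] (m : Measure α) {Φ : α → ℝ≥0∞}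
    (hΦ : Measurable Φ) (h : ∀ v, m {t | Φ t < v} ≤ v) :
    ∫⁻ t, Φ t ^ (-(1 / 2 : ℝ)) ∂m ≤ 2 * m univ ^ (1 / 2 : ℝ) := by
  rcases eq_or_ne (m univ) ⊤ with htop | htop
  · simp [htop]
  rcases eq_or_ne (m univ) 0 with h0 | h0
  · simp [Measure.measure_univ_eq_zero.1 h0]
  set a := (m univ).toReal with ha
  have hapos : 0 < a := ENNReal.toReal_pos h0 htop
  have hsqrt : 0 < √a := Real.sqrt_pos.2 hapos
  have hA : m univ = ENNReal.ofReal a := (ENNReal.ofReal_toReal htop).symm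
  have hfin : ∀ᵐ t ∂m, ENNReal.ofReal ((Φ t ^ (-(1 / 2 : ℝ))).toReal) = Φ t ^ (-(1 / 2 : ℝ)) := by
    filter_upwards [ae_ne_zero_of_measure_lt_le h] with t ht
    refine ENNReal.ofReal_toReal ?_
    simp [ENNReal.rpow_eq_top_iff, ht]
  have hmeas : Measurable fun t => (Φ t ^ (-(1 / 2 : ℝ))).toReal := (hΦ.pow_const _).ennreal_toReal
  rw [← lintegral_congr_ae hfin, lintegral_eq_lintegral_meas_lt m
    (Eventually.of_forall fun _ => ENNReal.toReal_nonneg) hmeas.aemeasurable]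
  -- `Φ^{-1/2} > t` means `Φ < t^{-2}`.
  have hlevel : ∀ t : ℝ, 0 < t → m {x | t < (Φ x ^ (-(1 / 2 : ℝ))).toReal}
      ≤ ENNReal.ofReal (t ^ (-2 : ℝ)) := by
    intro t ht
    refine le_trans (measure_mono fun x hx => ?_) (h _)
    simp only [mem_ofPred_eq] at hx ⊢
    by_contra hle
    rw [not_lt] at hle
    refine absurd hx (not_lt.2 ?_)
    refine ENNReal.toReal_le_of_le_ofReal ht.le ?_
    rw [ENNReal.rpow_neg, ENNReal.inv_le_iff_inv_le, ← ENNReal.ofReal_inv_of_pos ht]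
    calc ENNReal.ofReal t⁻¹ = ENNReal.ofReal (t ^ (-2 : ℝ)) ^ (1 / 2 : ℝ) := by
          rw [ENNReal.ofReal_rpow_of_pos (by positivity), ← Real.rpow_mul ht.le,
            ← Real.rpow_neg_one]
          norm_num
      _ ≤ _ := ENNReal.rpow_le_rpow hle (by norm_num)
  -- The bounds `a` and `t^{-2}` for the level sets cross at `t = (√a)⁻¹`; each side of this level
  -- contributes `√a`.
  have hT : 0 < (√a)⁻¹ := inv_pos.2 hsqrt
  rw [← Ioc_union_Ioi_eq_Ioi hT.le, lintegral_union measurableSet_Ioi (Ioc_disjoint_Ioi le_rfl)]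
  have h1 : ∫⁻ t in Ioc 0 (√a)⁻¹, m {x | t < (Φ x ^ (-(1 / 2 : ℝ))).toReal}
      ≤ ENNReal.ofReal √a := by
    calc _ ≤ ∫⁻ t in Ioc 0 (√a)⁻¹, m univ := lintegral_mono fun t => measure_mono (subset_univ _)
      _ = ENNReal.ofReal √a := by
        rw [setLIntegral_const, Real.volume_Ioc, sub_zero, hA, ← ENNReal.ofReal_mul hapos.le,
          ← div_eq_mul_inv, Real.div_sqrt]
  have h2 : ∫⁻ t in Ioi (√a)⁻¹, m {x | t < (Φ x ^ (-(1 / 2 : ℝ))).toReal}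
      ≤ ENNReal.ofReal √a := by
    calc _ ≤ ∫⁻ t in Ioi (√a)⁻¹, ENNReal.ofReal (t ^ (-2 : ℝ)) :=
          setLIntegral_mono' measurableSet_Ioi fun t ht => hlevel t (hT.trans ht)
      _ = ENNReal.ofReal √a := by
        rw [← ofReal_integral_eq_lintegral_ofReal (integrableOn_Ioi_rpow_of_lt (by norm_num) hT),
          integral_Ioi_rpow_of_lt (by norm_num) hT]
        · norm_num [Real.rpow_neg_one]
        · filter_upwards [ae_restrict_mem measurableSet_Ioi] with t ht
          exact Real.rpow_nonneg (hT.trans ht).le _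
  calc _ ≤ ENNReal.ofReal √a + ENNReal.ofReal √a := add_le_add h1 h2
    _ = 2 * m univ ^ (1 / 2 : ℝ) := by
      rw [hA, ENNReal.ofReal_rpow_of_pos hapos, ← Real.sqrt_eq_rpow, two_mul]

/-- The set is downward closed. With a largest element `c` it lies in `Iic c`, which has the mass of
`Iio c` because there are no atoms. Otherwise it is covered by countably many nested `Iic q` with
`q` in it, and continuity from below applies. No finiteness is needed. -/
theorem measure_setOf_measure_Iio_lt_le {α : Type*} [LinearOrder α] [DenselyOrdered α]
    [TopologicalSpace α] [OrderTopology α] [TopologicalSpace.SeparableSpace α] [MeasurableSpace α]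
    (s : Measure α) [NullSingletonClass s] (v : ℝ≥0∞) :
    s {t | s (Iio t) < v} ≤ v := by
  set D := {t | s (Iio t) < v} with hD
  have hIic : ∀ t ∈ D, s (Iic t) ≤ v := fun t ht => by
    rw [← measure_congr (Iio_ae_eq_Iic (μ := s) (a := t))]; exact ht.le
  have hlow : ∀ t ∈ D, ∀ u ≤ t, u ∈ D := fun t ht u hu =>
    lt_of_le_of_lt (measure_mono (Iio_subset_Iio hu)) ht
  by_cases hmax : ∃ c ∈ D, ∀ t ∈ D, t ≤ c
  · obtain ⟨c, hc, hle⟩ := hmax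
    exact (measure_mono fun t ht => hle t ht).trans (hIic c hc)
  · push Not at hmax
    obtain ⟨Q, hQc, hQd⟩ := TopologicalSpace.exists_countable_dense α
    have hsub : D ⊆ ⋃ q : ↥(Q ∩ D), Iic (q : α) := by
      intro t ht
      obtain ⟨t', ht', htt'⟩ := hmax t ht
      obtain ⟨q, hq, hq1, hq2⟩ := hQd.exists_between htt'
      exact mem_iUnion.2 ⟨⟨q, hq, hlow t' ht' q hq2.le⟩, hq1.le⟩
    have : Countable ↥(Q ∩ D) := (hQc.mono inter_subset_left).to_subtype
    refine (measure_mono hsub).trans ?_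
    rw [Directed.measure_iUnion]
    · exact iSup_le fun q => hIic q q.2.2
    · exact Monotone.directed_le fun p q hpq => Iic_subset_Iic.2 hpq

theorem measure_setOf_measure_Ioi_lt_le (s : Measure ℝ) [NullSingletonClass s] (v : ℝ≥0∞) :
    s {t | s (Ioi t) < v} ≤ v :=
  have : NullSingletonClass (α := ℝᵒᵈ) s := ‹NullSingletonClass s›
  measure_setOf_measure_Iio_lt_le (α := ℝᵒᵈ) s v

theorem sq_lintegral_mul_le {α : Type*} [MeasurableSpace α] (m : Measure α) {f g : α → ℝ≥0∞}
    (hf : Measurable f) (hg : Measurable g) :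
    (∫⁻ t, f t * g t ∂m) ^ 2 ≤ (∫⁻ t, f t ^ 2 ∂m) * ∫⁻ t, g t ^ 2 ∂m := by
  have h := ENNReal.lintegral_mul_le_Lp_mul_Lq m Real.HolderConjugate.two_two
    hf.aemeasurable hg.aemeasurable
  calc _ ≤ _ := pow_le_pow_left' h 2
    _ = _ := by
      simp only [ENNReal.rpow_two, mul_pow, ← ENNReal.rpow_natCast, ← ENNReal.rpow_mul]
      norm_num

/-- Muckenhoupt's form of Hardy's inequality, for the integral operator with kernel the indicator
of a relation `R`. In the applications `R` is `<` or `>`. -/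
theorem lintegral_sq_lintegral_le {α : Type*} [MeasurableSpace α] (s μ : Measure α) [SFinite s]
    [SFinite μ] (R : α → α → Prop) (hR : MeasurableSet {p : α × α | R p.1 p.2})
    (htr : ∀ t u x, R t u → R u x → R t x)
    (hs : ∀ v, s {t | s {u | R u t} < v} ≤ v) (hμ : ∀ v, μ {t | μ {u | R t u} < v} ≤ v)
    {B : ℝ≥0∞} (hBtop : B ≠ ⊤) (hB : ∀ x, s {t | R t x} * μ {t | R x t} ≤ B)
    {h : α → ℝ≥0∞} (hh : Measurable h) :
    ∫⁻ x, (∫⁻ t in {t | R t x}, h t ∂s) ^ 2 ∂μ ≤ 4 * B * ∫⁻ t, h t ^ 2 ∂s := by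
  set S : α → ℝ≥0∞ := fun x => s {t | R t x} with hSdef
  set M : α → ℝ≥0∞ := fun t => μ {x | R t x} with hMdef
  have hSm : Measurable S := measurable_measure_prodMk_right hR
  have hMm : Measurable M := measurable_measure_prodMk_left hR
  have hRl : ∀ x, MeasurableSet {t | R t x} := fun x => measurable_prodMk_right hR
  have hRr : ∀ t, MeasurableSet {x | R t x} := fun t => measurable_prodMk_left hR
  have hS0 : ∀ᵐ t ∂s, S t ≠ 0 := ae_ne_zero_of_measure_lt_le hs
  have hM0 : ∀ᵐ t ∂μ, M t ≠ 0 := ae_ne_zero_of_measure_lt_le hμ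
  -- Cauchy–Schwarz for `h = (h S^{1/4}) S^{-1/4}`; the second factor integrates to at most `2
  -- S(x)^{1/2}`.
  have hCS : ∀ x, S x ≠ ⊤ → (∫⁻ t in {t | R t x}, h t ∂s) ^ 2 ≤
      (∫⁻ t in {t | R t x}, h t ^ 2 * S t ^ (1 / 2 : ℝ) ∂s) * (2 * S x ^ (1 / 2 : ℝ)) := by
    intro x hx
    have hsplit : ∫⁻ t in {t | R t x}, h t ∂s
        = ∫⁻ t in {t | R t x}, (h t * S t ^ (1 / 4 : ℝ)) * S t ^ (-(1 / 4 : ℝ)) ∂s := by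
      refine lintegral_congr_ae ?_
      filter_upwards [ae_restrict_of_ae hS0, ae_restrict_mem (hRl x)] with t ht hRt
      have hle : S t ≤ S x := measure_mono fun u hu => htr u t x hu hRt
      rw [mul_assoc, ← ENNReal.rpow_add _ _ ht (ne_top_of_le_ne_top hx hle)]
      simp
    rw [hsplit]
    refine (sq_lintegral_mul_le _ (f := fun t => h t * S t ^ (1 / 4 : ℝ)) (by fun_prop)
      (hSm.pow_const _)).trans ?_
    have e1 : ∀ t, (h t * S t ^ (1 / 4 : ℝ)) ^ 2 = h t ^ 2 * S t ^ (1 / 2 : ℝ) := fun t => by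
      rw [mul_pow, ← ENNReal.rpow_natCast (S t ^ (1 / 4 : ℝ)), ← ENNReal.rpow_mul]
      norm_num
    have e2 : ∀ t, (S t ^ (-(1 / 4 : ℝ))) ^ 2 = S t ^ (-(1 / 2 : ℝ)) := fun t => by
      rw [← ENNReal.rpow_natCast, ← ENNReal.rpow_mul]
      norm_num
    simp only [e1, e2]
    gcongr
    refine (lintegral_rpow_neg_half_le _ hSm fun v =>
      (Measure.restrict_apply_le _ _).trans (hs v)).trans ?_
    rw [Measure.restrict_apply_univ]
  -- `S M ≤ B` trades the power of `S` for one of `M`, so that after Tonelli the inner `μ`-integral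
  -- has the same form as the `s`-integral before.
  have hSM : ∀ᵐ x ∂μ, S x ≠ ⊤ ∧ S x ^ (1 / 2 : ℝ) ≤ B ^ (1 / 2 : ℝ) * M x ^ (-(1 / 2 : ℝ)) := by
    filter_upwards [hM0] with x hx
    have hle : S x ≤ B / M x :=
      (ENNReal.le_div_iff_mul_le (Or.inl hx) (Or.inr hBtop)).2 (hB x)
    refine ⟨ne_top_of_le_ne_top (ENNReal.div_ne_top hBtop hx) hle, ?_⟩
    rw [ENNReal.rpow_neg, ← ENNReal.inv_rpow, ← ENNReal.mul_rpow_of_nonneg _ _ (by norm_num)]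
    exact ENNReal.rpow_le_rpow hle (by norm_num)
  have hk : Measurable fun p : α × α => {p : α × α | R p.1 p.2}.indicator
      (fun p => h p.1 ^ 2 * S p.1 ^ (1 / 2 : ℝ) * (2 * S p.2 ^ (1 / 2 : ℝ))) p :=
    Measurable.indicator (by fun_prop) hR
  calc ∫⁻ x, (∫⁻ t in {t | R t x}, h t ∂s) ^ 2 ∂μ
      ≤ ∫⁻ x, ∫⁻ t, {p : α × α | R p.1 p.2}.indicator
          (fun p => h p.1 ^ 2 * S p.1 ^ (1 / 2 : ℝ) * (2 * S p.2 ^ (1 / 2 : ℝ))) (t, x) ∂s ∂μ := by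
        refine lintegral_mono_ae ?_
        filter_upwards [hSM] with x hx
        refine (hCS x hx.1).trans (le_of_eq ?_)
        rw [← lintegral_mul_const _ (by fun_prop), ← lintegral_indicator (hRl x)]
        rfl
    _ = ∫⁻ t, ∫⁻ x, {p : α × α | R p.1 p.2}.indicator
          (fun p => h p.1 ^ 2 * S p.1 ^ (1 / 2 : ℝ) * (2 * S p.2 ^ (1 / 2 : ℝ))) (t, x) ∂μ ∂s :=
        lintegral_lintegral_swap (hk.comp measurable_swap).aemeasurable
    _ = ∫⁻ t, h t ^ 2 * S t ^ (1 / 2 : ℝ) * (2 * ∫⁻ x in {x | R t x}, S x ^ (1 / 2 : ℝ) ∂μ) ∂s := by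
        refine lintegral_congr fun t => ?_
        rw [← lintegral_const_mul _ (by fun_prop), ← lintegral_const_mul _ (by fun_prop),
          ← lintegral_indicator (hRr t)]
        rfl
    _ ≤ ∫⁻ t, 4 * B * h t ^ 2 ∂s := by
        refine lintegral_mono fun t => ?_
        have hin : ∫⁻ x in {x | R t x}, S x ^ (1 / 2 : ℝ) ∂μ
            ≤ B ^ (1 / 2 : ℝ) * (2 * M t ^ (1 / 2 : ℝ)) := by
          calc _ ≤ ∫⁻ x in {x | R t x}, B ^ (1 / 2 : ℝ) * M x ^ (-(1 / 2 : ℝ)) ∂μ :=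
                lintegral_mono_ae (ae_restrict_of_ae (hSM.mono fun x hx => hx.2))
            _ = B ^ (1 / 2 : ℝ) * ∫⁻ x in {x | R t x}, M x ^ (-(1 / 2 : ℝ)) ∂μ :=
                lintegral_const_mul _ (by fun_prop)
            _ ≤ _ := by
                gcongr
                refine (lintegral_rpow_neg_half_le _ hMm fun v =>
                  (Measure.restrict_apply_le _ _).trans (hμ v)).trans ?_
                rw [Measure.restrict_apply_univ]
        calc _ ≤ h t ^ 2 * S t ^ (1 / 2 : ℝ) * (2 * (B ^ (1 / 2 : ℝ) * (2 * M t ^ (1 / 2 : ℝ)))) := by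
              gcongr
          _ = 4 * B ^ (1 / 2 : ℝ) * (S t ^ (1 / 2 : ℝ) * M t ^ (1 / 2 : ℝ)) * h t ^ 2 := by ring
          _ ≤ 4 * B ^ (1 / 2 : ℝ) * B ^ (1 / 2 : ℝ) * h t ^ 2 := by
              gcongr
              rw [← ENNReal.mul_rpow_of_nonneg _ _ (by norm_num)]
              exact ENNReal.rpow_le_rpow (hB t) (by norm_num)
          _ = 4 * B * h t ^ 2 := by
              rw [mul_assoc 4, ← ENNReal.rpow_add_of_nonneg _ _ (by norm_num) (by norm_num)]
              norm_num
    _ = 4 * B * ∫⁻ t, h t ^ 2 ∂s := lintegral_const_mul _ (by fun_prop)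

theorem lintegral_sq_lintegral_le₀ {α : Type*} [MeasurableSpace α] (s μ : Measure α) [SFinite s]
    [SFinite μ] (R : α → α → Prop) (hR : MeasurableSet {p : α × α | R p.1 p.2})
    (htr : ∀ t u x, R t u → R u x → R t x)
    (hs : ∀ v, s {t | s {u | R u t} < v} ≤ v) (hμ : ∀ v, μ {t | μ {u | R t u} < v} ≤ v)
    {B : ℝ≥0∞} (hBtop : B ≠ ⊤) (hB : ∀ x, s {t | R t x} * μ {t | R x t} ≤ B)
    {h : α → ℝ≥0∞} (hh : AEMeasurable h s) :
    ∫⁻ x, (∫⁻ t in {t | R t x}, h t ∂s) ^ 2 ∂μ ≤ 4 * B * ∫⁻ t, h t ^ 2 ∂s := by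
  have e := hh.ae_eq_mk
  have := lintegral_sq_lintegral_le s μ R hR htr hs hμ hBtop hB hh.measurable_mk
  have e2 : ∫⁻ t, h t ^ 2 ∂s = ∫⁻ t, hh.mk h t ^ 2 ∂s :=
    lintegral_congr_ae (e.mono fun t ht => by simp only [ht])
  rw [e2]
  simpa only [lintegral_congr_ae (ae_restrict_of_ae e)] using this

end EllipticLine

/-! ### Intervals with extended real endpoints -/

namespace EllipticLine

section interval

variable {p q p' q' : EReal} {x y : ℝ}

theorem mem_interval : x ∈ interval p q ↔ p < x ∧ (x : EReal) < q := Iff.rfl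

theorem isOpen_interval (p q : EReal) : IsOpen (interval p q) :=
  isOpen_Ioo.preimage continuous_coe_real_ereal

theorem measurableSet_interval (p q : EReal) : MeasurableSet (interval p q) :=
  (isOpen_interval p q).measurableSet

theorem interval_subset (hp : p ≤ p') (hq : q' ≤ q) : interval p' q' ⊆ interval p q :=
  fun _ hx => ⟨hp.trans_lt hx.1, hx.2.trans_le hq⟩

theorem interval_coe (x y : ℝ) : interval x y = Ioo x y := by
  ext t; simp [mem_interval]

theorem Icc_subset_interval (hx : x ∈ interval p q) (hy : y ∈ interval p q) :
    Icc x y ⊆ interval p q := fun _ ht =>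
  ⟨hx.1.trans_le (EReal.coe_le_coe_iff.2 ht.1), (EReal.coe_le_coe_iff.2 ht.2).trans_lt hy.2⟩

theorem uIcc_subset_interval (hx : x ∈ interval p q) (hy : y ∈ interval p q) :
    uIcc x y ⊆ interval p q := by
  rcases le_total x y with h | h
  · rw [uIcc_of_le h]; exact Icc_subset_interval hx hy
  · rw [uIcc_of_ge h]; exact Icc_subset_interval hy hx

theorem volume_interval_pos (h : p < q) : volume (interval p q) ≠ 0 := by
  obtain ⟨x, hx⟩ := EReal.lt_iff_exists_real_btwn.1 h
  exact ((isOpen_interval p q).measure_pos volume ⟨x, hx⟩).ne'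

/-- Continuity from below, along rational `z` to keep the union countable. It replaces limits at an
end of `E` by suprema. -/
theorem measure_interval_eq_iSup_left (m : Measure ℝ) (p q : EReal) :
    m (interval p q) = ⨆ z ∈ interval p q, m (interval z q) := by
  refine le_antisymm ?_ (iSup₂_le fun z hz => measure_mono (interval_subset hz.1.le le_rfl))
  have hsub : interval p q ⊆ ⋃ r : {r : ℚ // (r : ℝ) ∈ interval p q}, interval ((r : ℚ) : ℝ) q := by
    intro x hx
    obtain ⟨r, hr1, hr2⟩ := EReal.lt_iff_exists_rat_btwn.1 hx.1
    exact mem_iUnion.2 ⟨⟨r, hr1, hr2.trans hx.2⟩, hr2, hx.2⟩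
  refine (measure_mono hsub).trans ?_
  rw [Directed.measure_iUnion]
  · exact iSup_le fun r => le_iSup₂_of_le ((r : ℚ) : ℝ) r.2 le_rfl
  · exact Antitone.directed_le fun a b hab =>
      interval_subset (EReal.coe_le_coe_iff.2 (by exact_mod_cast hab)) le_rfl

theorem measure_interval_eq_iSup_right (m : Measure ℝ) (p q : EReal) :
    m (interval p q) = ⨆ w ∈ interval p q, m (interval p w) := by
  refine le_antisymm ?_ (iSup₂_le fun z hz => measure_mono (interval_subset le_rfl hz.2.le))
  have hsub : interval p q ⊆ ⋃ r : {r : ℚ // (r : ℝ) ∈ interval p q}, interval p ((r : ℚ) : ℝ) := by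
    intro x hx
    obtain ⟨r, hr1, hr2⟩ := EReal.lt_iff_exists_rat_btwn.1 hx.2
    exact mem_iUnion.2 ⟨⟨r, hx.1.trans hr1, hr2⟩, hx.1, hr1⟩
  refine (measure_mono hsub).trans ?_
  rw [Directed.measure_iUnion]
  · exact iSup_le fun r => le_iSup₂_of_le ((r : ℚ) : ℝ) r.2 le_rfl
  · exact Monotone.directed_le fun a b hab =>
      interval_subset le_rfl (EReal.coe_le_coe_iff.2 (by exact_mod_cast hab))

theorem comap_nhdsGT_neBot (h : p < q) : (comap Real.toEReal (𝓝[>] p)).NeBot := by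
  refine comap_neBot_iff.2 fun t ht => ?_
  obtain ⟨u, hu, hsub⟩ := (mem_nhdsGT_iff_exists_Ioo_subset' h).1 ht
  obtain ⟨x, hx⟩ := EReal.lt_iff_exists_real_btwn.1 hu
  exact ⟨x, hsub hx⟩

theorem comap_nhdsLT_neBot (h : p < q) : (comap Real.toEReal (𝓝[<] q)).NeBot := by
  refine comap_neBot_iff.2 fun t ht => ?_
  obtain ⟨u, hu, hsub⟩ := (mem_nhdsLT_iff_exists_Ioo_subset' h).1 ht
  obtain ⟨x, hx⟩ := EReal.lt_iff_exists_real_btwn.1 hu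
  exact ⟨x, hsub hx⟩

theorem eventually_mem_interval_left (h : p < q) :
    ∀ᶠ z in comap Real.toEReal (𝓝[>] p), z ∈ interval p q :=
  preimage_mem_comap (Ioo_mem_nhdsGT h)

theorem eventually_mem_interval_right (h : p < q) :
    ∀ᶠ z in comap Real.toEReal (𝓝[<] q), z ∈ interval p q :=
  preimage_mem_comap (Ioo_mem_nhdsLT h)

end interval

/-! ### Speed and scale measures, and the weighted Hardy inequality -/

namespace Operator

variable {L : Operator} {f : ℝ → ℝ}

theorem measurableSet_E : MeasurableSet L.E := measurableSet_interval _ _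

theorem LocallyAC.continuousOn (hf : L.LocallyAC f) : ContinuousOn f L.E := by
  intro x hx
  obtain ⟨l, u, hlu, hsub⟩ :=
    mem_nhds_iff_exists_Ioo_subset.1 ((isOpen_interval _ _).mem_nhds hx)
  obtain ⟨y, hy⟩ := exists_between hlu.1
  obtain ⟨z, hz⟩ := exists_between hlu.2
  have hyz : y ≤ z := (hy.2.trans hz.1).le
  have := (hf y (hsub ⟨hy.1, hy.2.trans hlu.2⟩) z (hsub ⟨hlu.1.trans hz.1, hz.2⟩)).continuousOn
  rw [uIcc_of_le hyz] at this
  exact (this.continuousAt (Icc_mem_nhds hy.2 hz.1)).continuousWithinAt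

theorem LocallyAC.aemeasurable (hf : L.LocallyAC f) : AEMeasurable f (volume.restrict L.E) :=
  hf.continuousOn.aemeasurable measurableSet_E

theorem LocallyAC.enorm_sub_le (hf : L.LocallyAC f) {x y : ℝ} (hx : x ∈ L.E) (hy : y ∈ L.E)
    (hxy : x ≤ y) : ‖f y - f x‖ₑ ≤ ∫⁻ t in Ioo x y, ‖deriv f t‖ₑ := by
  rw [← (hf x hx y hy).integral_deriv_eq_sub, intervalIntegral.integral_of_le hxy,
    ← restrict_Ioo_eq_restrict_Ioc]
  exact enorm_integral_le_lintegral_enorm _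

/-- The fundamental theorem of calculus holds on `[z, x]`; let `z` tend to the end. The bound may be
infinite, so no integrability of `f'` up to the end is needed. -/
theorem LocallyAC.enorm_le_of_vanishesAtLo (hf : L.LocallyAC f) (h0 : L.VanishesAtLo f) {x : ℝ}
    (hx : x ∈ L.E) : ‖f x‖ₑ ≤ ∫⁻ t in interval L.lo x, ‖deriv f t‖ₑ := by
  have := comap_nhdsGT_neBot hx.1
  have hlim : Tendsto (fun z => ‖f x - f z‖ₑ) (comap Real.toEReal (𝓝[>] L.lo)) (𝓝 ‖f x - 0‖ₑ) :=
    (tendsto_const_nhds.sub h0).enorm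
  rw [sub_zero] at hlim
  refine le_of_tendsto hlim ?_
  filter_upwards [eventually_mem_interval_left hx.1] with z hz
  refine (hf.enorm_sub_le ⟨hz.1, hz.2.trans hx.2⟩ hx (EReal.coe_le_coe_iff.1 hz.2.le)).trans ?_
  rw [← interval_coe]
  exact lintegral_mono_set (interval_subset hz.1.le le_rfl)

theorem LocallyAC.enorm_le_of_vanishesAtHi (hf : L.LocallyAC f) (h0 : L.VanishesAtHi f) {x : ℝ}
    (hx : x ∈ L.E) : ‖f x‖ₑ ≤ ∫⁻ t in interval x L.hi, ‖deriv f t‖ₑ := by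
  have := comap_nhdsLT_neBot hx.2
  have hlim : Tendsto (fun z => ‖f z - f x‖ₑ) (comap Real.toEReal (𝓝[<] L.hi)) (𝓝 ‖0 - f x‖ₑ) :=
    (h0.sub tendsto_const_nhds).enorm
  rw [zero_sub, enorm_neg] at hlim
  refine le_of_tendsto hlim ?_
  filter_upwards [eventually_mem_interval_right hx.2] with z hz
  refine (hf.enorm_sub_le hx ⟨hx.1.trans hz.1, hz.2⟩ (EReal.coe_le_coe_iff.1 hz.1.le)).trans ?_
  rw [← interval_coe]
  exact lintegral_mono_set (interval_subset le_rfl hz.2.le)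

theorem locallyAC_integral {g : ℝ → ℝ} {c : ℝ} (hc : c ∈ L.E)
    (hg : ∀ u ∈ L.E, ∀ v ∈ L.E, IntervalIntegrable g volume u v) :
    L.LocallyAC fun x => ∫ t in c..x, g t := by
  intro x hx y hy
  have ha : min c (min x y) ∈ L.E := min_rec' (· ∈ L.E) hc (min_rec' (· ∈ L.E) hx hy)
  have hb : max c (max x y) ∈ L.E := max_rec' (· ∈ L.E) hc (max_rec' (· ∈ L.E) hx hy)
  have hab : min c (min x y) ≤ max c (max x y) := (min_le_left _ _).trans (le_max_left _ _)
  refine ((hg _ ha _ hb).absolutelyContinuousOnInterval_intervalIntegral (c := c) ?_).mono ?_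
  · simp
  · rw [uIcc_of_le hab]
    exact Icc_subset_Icc (min_le_right _ _) (le_max_right _ _)

theorem IsElliptic.locallyAC_C (hL : L.IsElliptic) : L.LocallyAC L.C :=
  locallyAC_integral hL.ref_mem fun _ hu _ hv => (hL.locInt_drift.integrableOn_compact_subset
    (uIcc_subset_interval hu hv) isCompact_uIcc).intervalIntegrable

theorem IsElliptic.continuousOn_C (hL : L.IsElliptic) : ContinuousOn L.C L.E :=
  hL.locallyAC_C.continuousOn

theorem IsElliptic.aemeasurable_C (hL : L.IsElliptic) :
    AEMeasurable L.C (volume.restrict L.E) := hL.locallyAC_C.aemeasurable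

theorem IsElliptic.aemeasurable_speedDensity (hL : L.IsElliptic) :
    AEMeasurable (fun x => ENNReal.ofReal (Real.exp (L.C x) / L.a x)) (volume.restrict L.E) := by
  have h := hL.locInt_inv.aestronglyMeasurable.aemeasurable
  simp only [div_eq_mul_one_div (Real.exp _)]
  exact ((Real.measurable_exp.comp_aemeasurable hL.aemeasurable_C).mul h).ennreal_ofReal

theorem IsElliptic.aemeasurable_scaleDensity (hL : L.IsElliptic) :
    AEMeasurable (fun x => ENNReal.ofReal (Real.exp (-L.C x))) (volume.restrict L.E) :=
  (Real.measurable_exp.comp_aemeasurable hL.aemeasurable_C.neg).ennreal_ofReal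

instance : SFinite L.speed := by unfold speed; infer_instance
instance : SFinite L.scale := by unfold scale; infer_instance
instance : NullSingletonClass L.speed := by unfold speed; infer_instance
instance : NullSingletonClass L.scale := by unfold scale; infer_instance

theorem IsElliptic.setLIntegral_scale (hL : L.IsElliptic) {J : Set ℝ} (hJ : MeasurableSet J)
    (hJE : J ⊆ L.E) (g : ℝ → ℝ≥0∞) :
    ∫⁻ t in J, g t ∂L.scale = ∫⁻ t in J, ENNReal.ofReal (Real.exp (-L.C t)) * g t := by
  rw [scale, setLIntegral_withDensity_eq_setLIntegral_mul_non_measurable₀ _ _ _ hJ (by simp),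
    Measure.restrict_restrict_of_subset hJE]
  · rfl
  · exact hL.aemeasurable_scaleDensity.mono_measure Measure.restrict_le_self

theorem IsElliptic.speed_ne_zero (hL : L.IsElliptic) {p q : EReal} (hp : L.lo ≤ p)
    (hq : q ≤ L.hi) (h : p < q) : L.speed (interval p q) ≠ 0 := by
  have hac : volume.restrict L.E ≪ L.speed :=
    withDensity_absolutelyContinuous' hL.aemeasurable_speedDensity <| by
      filter_upwards [ae_restrict_mem measurableSet_E] with x hx
      simpa using div_pos (Real.exp_pos _) (hL.a_pos x hx)
  intro h0
  have := hac h0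
  rw [Measure.restrict_eq_self _ (show interval p q ⊆ L.E from interval_subset hp hq)] at this
  exact volume_interval_pos h this

theorem IsElliptic.scale_ne_zero (hL : L.IsElliptic) {p q : EReal} (hp : L.lo ≤ p)
    (hq : q ≤ L.hi) (h : p < q) : L.scale (interval p q) ≠ 0 := by
  have hac : volume.restrict L.E ≪ L.scale :=
    withDensity_absolutelyContinuous' hL.aemeasurable_scaleDensity <|
      Eventually.of_forall fun x => by simpa using Real.exp_pos _
  intro h0
  have := hac h0
  rw [Measure.restrict_eq_self _ (show interval p q ⊆ L.E from interval_subset hp hq)] at this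
  exact volume_interval_pos h this

theorem IsElliptic.integrableOn_exp_neg_C (hL : L.IsElliptic) {x y : ℝ} (hx : x ∈ L.E)
    (hy : y ∈ L.E) : IntegrableOn (fun t => Real.exp (-L.C t)) (Icc x y) :=
  (Real.continuous_exp.comp_continuousOn
    (hL.continuousOn_C.mono (Icc_subset_interval hx hy)).neg).integrableOn_Icc

theorem IsElliptic.scale_coe (hL : L.IsElliptic) {x y : ℝ} (hx : x ∈ L.E) (hy : y ∈ L.E) :
    L.scale (interval x y) = ENNReal.ofReal (∫ t in Ioc x y, Real.exp (-L.C t)) := by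
  have hsub : Ioo x y ⊆ L.E := Ioo_subset_Icc_self.trans (Icc_subset_interval hx hy)
  rw [interval_coe, scale, withDensity_apply _ measurableSet_Ioo,
    Measure.restrict_restrict_of_subset hsub, restrict_Ioo_eq_restrict_Ioc,
    ofReal_integral_eq_lintegral_ofReal
      ((hL.integrableOn_exp_neg_C hx hy).mono_set Ioc_subset_Icc_self)
      (Eventually.of_forall fun t => (Real.exp_pos _).le)]

theorem IsElliptic.scale_coe_ne_top (hL : L.IsElliptic) {x y : ℝ} (hx : x ∈ L.E) (hy : y ∈ L.E) :
    L.scale (interval x y) ≠ ⊤ := by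
  rw [hL.scale_coe hx hy]; exact ENNReal.ofReal_ne_top

theorem IsElliptic.speed_coe_ne_top (hL : L.IsElliptic) {x y : ℝ} (hx : x ∈ L.E) (hy : y ∈ L.E) :
    L.speed (interval x y) ≠ ⊤ := by
  have hsub : Icc x y ⊆ L.E := Icc_subset_interval hx hy
  have hint : IntegrableOn (fun t => Real.exp (L.C t) * (1 / L.a t)) (Icc x y) :=
    (hL.locInt_inv.integrableOn_compact_subset hsub isCompact_Icc).continuousOn_mul
      (Real.continuous_exp.comp_continuousOn (hL.continuousOn_C.mono hsub)) isCompact_Icc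
  rw [interval_coe]
  refine ne_top_of_le_ne_top ?_ (measure_mono Ioo_subset_Icc_self)
  rw [speed, withDensity_apply _ measurableSet_Icc, Measure.restrict_restrict_of_subset hsub]
  simp only [div_eq_mul_one_div (Real.exp _)]
  exact hint.lintegral_lt_top.ne

theorem speed_coe_self (x : ℝ) : L.speed (interval x x) = 0 := by
  simp [interval_coe]

theorem speed_compl_E : L.speed L.Eᶜ = 0 := by
  refine withDensity_absolutelyContinuous _ _ ?_
  rw [Measure.restrict_apply measurableSet_E.compl, compl_inter_self, measure_empty]

theorem restrict_speed_E : L.speed.restrict L.E = L.speed :=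
  Measure.restrict_eq_self_of_ae_mem speed_compl_E

/-- The weighted Hardy inequality on a part `J` of the state space, for functions dominated by the
integral of their derivative over `{t ∈ J | R t x}`. -/
theorem IsElliptic.hardy (hL : L.IsElliptic) {J : Set ℝ} (hJ : MeasurableSet J) (hJE : J ⊆ L.E)
    (R : ℝ → ℝ → Prop) (hR : MeasurableSet {p : ℝ × ℝ | R p.1 p.2})
    (htr : ∀ t u x, R t u → R u x → R t x)
    (hs : ∀ v, (L.scale.restrict J) {t | L.scale.restrict J {u | R u t} < v} ≤ v)
    (hμ : ∀ v, (L.speed.restrict J) {t | L.speed.restrict J {u | R t u} < v} ≤ v)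
    {B : ℝ≥0∞} (hBtop : B ≠ ⊤)
    (hB : ∀ x, L.scale.restrict J {t | R t x} * L.speed.restrict J {t | R x t} ≤ B)
    (h0 : ∀ x ∈ J, ‖f x‖ₑ ≤ ∫⁻ t in {t | R t x} ∩ J, ‖deriv f t‖ₑ) :
    ∫⁻ x in J, ‖f x‖ₑ ^ 2 ∂L.speed
      ≤ 4 * B * ∫⁻ x in J, ‖deriv f x‖ₑ ^ 2 * ENNReal.ofReal (Real.exp (L.C x)) := by
  have hexp : ∀ t, ENNReal.ofReal (Real.exp (-L.C t)) * ENNReal.ofReal (Real.exp (L.C t)) = 1 :=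
    fun t => by
      rw [← ENNReal.ofReal_mul (Real.exp_pos _).le, ← Real.exp_add, neg_add_cancel, Real.exp_zero,
        ENNReal.ofReal_one]
  have hRl : ∀ x, MeasurableSet {t | R t x} := fun x => measurable_prodMk_right hR
  -- The density of `|f'| dt` with respect to the scale measure; `h² dν̂ = f'² e^C dt` is then the
  -- energy density.
  set h : ℝ → ℝ≥0∞ := fun t => ‖deriv f t‖ₑ * ENNReal.ofReal (Real.exp (L.C t)) with hh
  have hm : AEMeasurable h (L.scale.restrict J) := by
    have : AEMeasurable h (volume.restrict L.E) :=
      (measurable_deriv f).enorm.aemeasurable.mul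
        (Real.measurable_exp.comp_aemeasurable hL.aemeasurable_C).ennreal_ofReal
    exact (this.mono_ac (withDensity_absolutelyContinuous _ _)).mono_measure
      Measure.restrict_le_self
  calc ∫⁻ x in J, ‖f x‖ₑ ^ 2 ∂L.speed
      ≤ ∫⁻ x in J, (∫⁻ t in {t | R t x}, h t ∂(L.scale.restrict J)) ^ 2 ∂L.speed := by
        refine setLIntegral_mono' hJ fun x hx => pow_le_pow_left' ((h0 x hx).trans (le_of_eq ?_)) 2
        rw [Measure.restrict_restrict (hRl x), hL.setLIntegral_scale ((hRl x).inter hJ)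
          (inter_subset_right.trans hJE)]
        refine lintegral_congr fun t => ?_
        rw [hh]
        simp only
        rw [mul_left_comm, hexp, mul_one]
    _ ≤ 4 * B * ∫⁻ t in J, h t ^ 2 ∂L.scale :=
        lintegral_sq_lintegral_le₀ _ _ R hR htr hs hμ hBtop hB hm
    _ = _ := by
        rw [hL.setLIntegral_scale hJ hJE]
        congr 1
        refine lintegral_congr fun t => ?_
        rw [hh]
        simp only
        calc _ = ENNReal.ofReal (Real.exp (-L.C t)) * ENNReal.ofReal (Real.exp (L.C t)) *
              (‖deriv f t‖ₑ ^ 2 * ENNReal.ofReal (Real.exp (L.C t))) := by ring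
          _ = _ := by rw [hexp, one_mul]

theorem IsElliptic.hardy_left (hL : L.IsElliptic) {p q : EReal} (hp : L.lo ≤ p) (hq : q ≤ L.hi)
    {B : ℝ≥0∞} (hBtop : B ≠ ⊤)
    (hB : ∀ x ∈ interval p q, L.scale (interval p x) * L.speed (interval x q) ≤ B)
    (h0 : ∀ x ∈ interval p q, ‖f x‖ₑ ≤ ∫⁻ t in interval p x, ‖deriv f t‖ₑ) :
    ∫⁻ x in interval p q, ‖f x‖ₑ ^ 2 ∂L.speed
      ≤ 4 * B * ∫⁻ x in interval p q, ‖deriv f x‖ₑ ^ 2 * ENNReal.ofReal (Real.exp (L.C x)) := by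
  have hJ := measurableSet_interval p q
  refine hL.hardy hJ (interval_subset hp hq) (· < ·) (measurableSet_lt measurable_fst measurable_snd)
    (fun _ _ _ => lt_trans) (measure_setOf_measure_Iio_lt_le _) (measure_setOf_measure_Ioi_lt_le _)
    hBtop (fun x => ?_) (fun x hx => (h0 x hx).trans (lintegral_mono_set ?_))
  · by_cases hx : x ∈ interval p q
    · refine le_trans ?_ (hB x hx)
      rw [Measure.restrict_apply' hJ, Measure.restrict_apply' hJ]
      gcongr
      · exact fun t ht => ⟨ht.2.1, EReal.coe_lt_coe_iff.2 ht.1⟩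
      · exact fun t ht => ⟨EReal.coe_lt_coe_iff.2 ht.1, ht.2.2⟩
    -- Outside the interval one of the two sets is empty, so the product is 0.
    · rw [Measure.restrict_apply' hJ, Measure.restrict_apply' hJ]
      rw [mem_interval, not_and_or, not_lt, not_lt] at hx
      rcases hx with hx | hx
      · have : {t : ℝ | t < x} ∩ interval p q = ∅ := eq_empty_of_forall_notMem fun t ht =>
          lt_irrefl _ ((ht.2.1.trans (EReal.coe_lt_coe_iff.2 ht.1)).trans_le hx)
        simp [this]
      · have : {t : ℝ | x < t} ∩ interval p q = ∅ := eq_empty_of_forall_notMem fun t ht =>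
          lt_irrefl _ (((EReal.coe_lt_coe_iff.2 ht.1).trans ht.2.2).trans_le hx)
        simp [this]
  · exact fun t ht => ⟨EReal.coe_lt_coe_iff.1 ht.2, ht.1, ht.2.trans hx.2⟩

theorem IsElliptic.hardy_right (hL : L.IsElliptic) {p q : EReal} (hp : L.lo ≤ p) (hq : q ≤ L.hi)
    {B : ℝ≥0∞} (hBtop : B ≠ ⊤)
    (hB : ∀ x ∈ interval p q, L.speed (interval p x) * L.scale (interval x q) ≤ B)
    (h0 : ∀ x ∈ interval p q, ‖f x‖ₑ ≤ ∫⁻ t in interval x q, ‖deriv f t‖ₑ) :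
    ∫⁻ x in interval p q, ‖f x‖ₑ ^ 2 ∂L.speed
      ≤ 4 * B * ∫⁻ x in interval p q, ‖deriv f x‖ₑ ^ 2 * ENNReal.ofReal (Real.exp (L.C x)) := by
  have hJ := measurableSet_interval p q
  refine hL.hardy hJ (interval_subset hp hq) (fun t x => x < t)
    (measurableSet_lt measurable_snd measurable_fst)
    (fun _ _ _ h h' => h'.trans h) (measure_setOf_measure_Ioi_lt_le _)
    (measure_setOf_measure_Iio_lt_le _)
    hBtop (fun x => ?_) (fun x hx => (h0 x hx).trans (lintegral_mono_set ?_))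
  · rw [mul_comm]
    by_cases hx : x ∈ interval p q
    · refine le_trans ?_ (hB x hx)
      rw [Measure.restrict_apply' hJ, Measure.restrict_apply' hJ]
      gcongr
      · exact fun t ht => ⟨ht.2.1, EReal.coe_lt_coe_iff.2 ht.1⟩
      · exact fun t ht => ⟨EReal.coe_lt_coe_iff.2 ht.1, ht.2.2⟩
    · rw [Measure.restrict_apply' hJ, Measure.restrict_apply' hJ]
      rw [mem_interval, not_and_or, not_lt, not_lt] at hx
      rcases hx with hx | hx
      · have : {t : ℝ | t < x} ∩ interval p q = ∅ := eq_empty_of_forall_notMem fun t ht =>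
          lt_irrefl _ ((ht.2.1.trans (EReal.coe_lt_coe_iff.2 ht.1)).trans_le hx)
        simp [this]
      · have : {t : ℝ | x < t} ∩ interval p q = ∅ := eq_empty_of_forall_notMem fun t ht =>
          lt_irrefl _ (((EReal.coe_lt_coe_iff.2 ht.1).trans ht.2.2).trans_le hx)
        simp [this]
  · exact fun t ht => ⟨EReal.coe_lt_coe_iff.1 ht.1, hx.1.trans ht.1, ht.2⟩

end Operator

end EllipticLine

/-! ### Lower bounds: cutting the interval -/

namespace EllipticLine

theorem enorm_sq_eq_ofReal (a : ℝ) : ‖a‖ₑ ^ 2 = ENNReal.ofReal (a ^ 2) := by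
  rw [Real.enorm_eq_ofReal_abs, ← ENNReal.ofReal_pow (abs_nonneg a), sq_abs]

theorem inv_mul_le_of_le_mul {a b c : ℝ≥0∞} (h : b ≤ a * c) : a⁻¹ * b ≤ c := by
  rcases eq_or_ne a 0 with rfl | h0
  · simp [le_zero_iff.1 (h.trans_eq (zero_mul c))]
  rcases eq_or_ne a ⊤ with rfl | ht
  · simp
  exact (ENNReal.inv_mul_le_iff h0 ht).2 h

/-- Replacing `f` by `f - c` lowers the second moment by at most the squared mean. -/
theorem lintegral_sq_le_lintegral_sq_sub_add {α : Type*} [MeasurableSpace α] (m : Measure α)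
    [IsFiniteMeasure m] {f : α → ℝ} (hf : Integrable f m) (c : ℝ) :
    ∫⁻ x, ENNReal.ofReal (f x ^ 2) ∂m ≤ ∫⁻ x, ENNReal.ofReal ((f x - c) ^ 2) ∂m
      + ENNReal.ofReal ((∫ x, f x ∂m) ^ 2 / m.real univ) := by
  rcases eq_or_ne m 0 with rfl | hm
  · simp
  have hM : 0 < m.real univ := by
    rw [measureReal_def]
    exact ENNReal.toReal_pos (by simpa using hm) (measure_ne_top _ _)
  rcases eq_or_ne (∫⁻ x, ENNReal.ofReal ((f x - c) ^ 2) ∂m) ⊤ with htop | htop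
  · simp [htop]
  have hi : Integrable (fun x => (f x - c) ^ 2) m := by
    have hmeas : AEStronglyMeasurable (fun x => (f x - c) ^ 2) m :=
      (hf.aestronglyMeasurable.sub aestronglyMeasurable_const).pow 2
    exact (lintegral_ofReal_ne_top_iff_integrable hmeas
      (Eventually.of_forall fun x => sq_nonneg _)).1 htop
  have e : (fun x => f x ^ 2) = fun x => (f x - c) ^ 2 + (2 * c * f x - c ^ 2) := by
    ext x; ring
  have hi2 : Integrable (fun x => 2 * c * f x - c ^ 2) m :=
    (hf.const_mul _).sub (integrable_const _)
  have hi3 : Integrable (fun x => f x ^ 2) m := by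
    rw [e]; exact hi.add hi2
  rw [← ofReal_integral_eq_lintegral_ofReal hi3 (Eventually.of_forall fun x => sq_nonneg _),
    ← ofReal_integral_eq_lintegral_ofReal hi (Eventually.of_forall fun x => sq_nonneg _),
    ← ENNReal.ofReal_add (integral_nonneg fun x => sq_nonneg _)
      (div_nonneg (sq_nonneg _) hM.le)]
  refine ENNReal.ofReal_le_ofReal ?_
  rw [e, integral_add hi hi2, integral_sub (hf.const_mul _) (integrable_const _),
    integral_const_mul, integral_const, smul_eq_mul]
  gcongr
  rw [le_div_iff₀ hM]
  -- With `I = ∫ f` and total mass `M`, this is `2cI - c²M ≤ I²/M`.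
  nlinarith [sq_nonneg (∫ x, f x ∂m - m.real univ * c)]

section split

variable {lo hi : EReal} {m n : Measure ℝ} {κ K : ℝ≥0∞}

/-- A point splitting `(lo, hi)` for a dichotomy `P ∨ Q`. -/
theorem exists_split (h : lo ≤ hi) {P Q : ℝ → Prop} (hPQ : ∀ θ ∈ interval lo hi, P θ ∨ Q θ) :
    ∃ c, lo ≤ c ∧ c ≤ hi ∧ (∀ w ∈ interval lo c, ∃ θ ∈ interval w hi, θ ∈ interval lo hi ∧
      (θ : EReal) ≤ c ∧ P θ) ∧ ∀ z ∈ interval c hi, Q z := by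
  -- `c` is the supremum of the points satisfying `P`. No monotonicity of `P` is needed: such points
  -- exist arbitrarily close to `c` from below (or at `c`), and beyond `c` only `Q` is left.
  -- Inserting `lo` covers the case that `P` never holds.
  set A : Set EReal := insert lo (Real.toEReal '' {θ | θ ∈ interval lo hi ∧ P θ}) with hA
  have hlo : lo ≤ sSup A := le_sSup (mem_insert _ _)
  refine ⟨sSup A, hlo, sSup_le ?_, fun w hw => ?_, fun z hz => ?_⟩
  · rintro _ (rfl | ⟨θ, hθ, rfl⟩)
    · exact h
    · exact hθ.1.2.le
  · obtain ⟨a, ha, hwa⟩ := lt_sSup_iff.1 hw.2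
    rcases ha with rfl | ⟨θ, hθ, rfl⟩
    · exact absurd (hwa.trans hw.1) (lt_irrefl _)
    · exact ⟨θ, ⟨hwa, hθ.1.2⟩, hθ.1, le_sSup (Or.inr ⟨θ, hθ, rfl⟩), hθ.2⟩
  · have hzE : z ∈ interval lo hi := ⟨hlo.trans_lt hz.1, hz.2⟩
    refine (hPQ z hzE).resolve_left fun hP => ?_
    exact absurd (le_sSup (mem_insert_of_mem lo ⟨z, ⟨hzE, hP⟩, rfl⟩ : (z : EReal) ∈ A)) (not_le.2 hz.1)

theorem measure_interval_le_add [NullSingletonClass m] (lo c hi : EReal) :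
    m (interval lo hi) ≤ m (interval lo c) + m (interval c hi) := by
  have hsub : interval lo hi ⊆ (interval lo c ∪ interval c hi) ∪ {x : ℝ | (x : EReal) = c} := by
    intro x hx
    rcases lt_trichotomy (x : EReal) c with h | h | h
    · exact Or.inl (Or.inl ⟨hx.1, h⟩)
    · exact Or.inr h
    · exact Or.inl (Or.inr ⟨h, hx.2⟩)
  have hz : m {x : ℝ | (x : EReal) = c} = 0 := Set.Subsingleton.measure_zero
    (fun x (hx : _ = _) y (hy : _ = _) => EReal.coe_injective (hx.trans hy.symm)) m
  refine (measure_mono hsub).trans ((measure_union_le _ _).trans ?_)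
  rw [hz, add_zero]
  exact measure_union_le _ _

theorem add_measure_interval_le {c : EReal} (h : lo ≤ c) (h' : c ≤ hi) :
    m (interval lo c) + m (interval c hi) ≤ m (interval lo hi) := by
  rw [← measure_union _ (measurableSet_interval _ _)]
  · exact measure_mono (union_subset (interval_subset le_rfl h') (interval_subset h le_rfl))
  · exact Set.disjoint_left.2 fun x hx hx' => lt_irrefl _ (hx.2.trans hx'.1)

/-- The two alternatives need not hold at a common `θ`: each is carried to the cut `c` by
monotonicity and continuity from below, and the pieces add up. -/
theorem measure_interval_le_of_forall_or [NullSingletonClass m] (h : lo ≤ hi)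
    (hmn : ∀ θ ∈ interval lo hi, m (interval lo θ) ≤ K * n (interval lo θ) ∨
      m (interval θ hi) ≤ K * n (interval θ hi)) :
    m (interval lo hi) ≤ K * n (interval lo hi) := by
  obtain ⟨c, hc, hc', hP, hQ⟩ := exists_split h hmn
  calc m (interval lo hi) ≤ m (interval lo c) + m (interval c hi) := measure_interval_le_add _ _ _
    _ ≤ K * n (interval lo c) + K * n (interval c hi) := by
        gcongr
        · rw [measure_interval_eq_iSup_right]
          refine iSup₂_le fun w hw => ?_
          obtain ⟨θ, hwθ, -, hθc, hθ⟩ := hP w hw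
          refine (measure_mono (interval_subset le_rfl hwθ.1.le)).trans (hθ.trans ?_)
          gcongr
          exact interval_subset le_rfl hθc
        · rw [measure_interval_eq_iSup_left]
          refine iSup₂_le fun z hz => (hQ z hz).trans ?_
          gcongr
          exact interval_subset hz.1.le le_rfl
    _ ≤ K * n (interval lo hi) := by
        rw [← mul_add]
        gcongr
        exact add_measure_interval_le hc hc'

/-- Failures at `x < θ < y` give `κ / m(lo,x) < n(x,θ)` and `κ / m(y,hi) < n(θ,y)`, whose sum
contradicts the bound at `(x, y)`. DD takes `m` scale and `n` speed, NN the reverse. -/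
theorem forall_le_or_forall_le [NullSingletonClass n] (hκ : κ ≠ ⊤)
    (hm : ∀ p q, lo ≤ p → q ≤ hi → p < q → m (interval p q) ≠ 0)
    (h : ∀ x ∈ interval lo hi, ∀ y ∈ interval lo hi, x < y →
      (((m (interval lo x))⁻¹ + (m (interval y hi))⁻¹) * (n (interval x y))⁻¹)⁻¹ ≤ κ)
    {θ : ℝ} (hθ : θ ∈ interval lo hi) :
    (∀ x ∈ interval lo θ, m (interval lo x) * n (interval x θ) ≤ κ) ∨
      ∀ y ∈ interval θ hi, n (interval θ y) * m (interval y hi) ≤ κ := by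
  by_contra hcon
  push Not at hcon
  obtain ⟨⟨x, hx, hxκ⟩, y, hy, hyκ⟩ := hcon
  have hxE : x ∈ interval lo hi := ⟨hx.1, hx.2.trans hθ.2⟩
  have hyE : y ∈ interval lo hi := ⟨hθ.1.trans hy.1, hy.2⟩
  have hxy : x < y := EReal.coe_lt_coe_iff.1 (hx.2.trans hy.1)
  have h1 := hm lo x le_rfl hxE.2.le hx.1
  have h2 := hm y hi hyE.1.le le_rfl hy.2
  have hle := h x hxE y hyE hxy
  set A := (m (interval lo x))⁻¹ + (m (interval y hi))⁻¹ with hA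
  have hAtop : A ≠ ⊤ := by simp [hA, h1, h2]
  -- If both outer masses were infinite, the left side of `hle` would be `⊤`.
  have hA0 : A ≠ 0 := fun h0 => hκ (top_le_iff.1 (by simpa [h0] using hle))
  rw [ENNReal.mul_inv (Or.inl hA0) (Or.inl hAtop), inv_inv, ENNReal.inv_mul_le_iff hA0 hAtop] at hle
  have e1 : κ / m (interval lo x) < n (interval x θ) :=
    (ENNReal.div_lt_iff (Or.inl h1) (Or.inr hκ)).2
      (hxκ.trans_eq (mul_comm _ _))
  have e2 : κ / m (interval y hi) < n (interval θ y) :=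
    (ENNReal.div_lt_iff (Or.inl h2) (Or.inr hκ)).2 hyκ
  refine absurd hle (not_le.2 ?_)
  calc A * κ = κ / m (interval lo x) + κ / m (interval y hi) := by
        rw [hA, mul_comm, mul_add, div_eq_mul_inv, div_eq_mul_inv]
    _ < n (interval x θ) + n (interval θ y) := ENNReal.add_lt_add e1 e2
    _ ≤ n (interval x y) := add_measure_interval_le hx.2.le hy.1.le

end split

namespace Operator

variable {L : Operator} {f : ℝ → ℝ}

/-- The energy of `f` as a measure, `f'² e^C dx`. -/
noncomputable def energyMeasure (L : Operator) (f : ℝ → ℝ) : Measure ℝ :=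
  volume.withDensity fun x => ‖deriv f x‖ₑ ^ 2 * ENNReal.ofReal (Real.exp (L.C x))

theorem energyMeasure_apply {J : Set ℝ} (hJ : MeasurableSet J) :
    L.energyMeasure f J
      = ∫⁻ x in J, ‖deriv f x‖ₑ ^ 2 * ENNReal.ofReal (Real.exp (L.C x)) :=
  withDensity_apply _ hJ

theorem energy_eq : L.energy f = L.energyMeasure f L.E := by
  rw [energyMeasure_apply measurableSet_E, energy]
  refine lintegral_congr fun x => ?_
  rw [enorm_sq_eq_ofReal, ENNReal.ofReal_mul (sq_nonneg _)]

theorem energyMeasure_sub_const (c : ℝ) :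
    L.energyMeasure (fun x => f x - c) = L.energyMeasure f := by
  simp [energyMeasure]

theorem normSq_eq : L.normSq f = (L.speed.withDensity fun x => ‖f x‖ₑ ^ 2) L.E := by
  rw [withDensity_apply _ measurableSet_E, normSq, restrict_speed_E]
  simp only [enorm_sq_eq_ofReal]

theorem inv_le_leadingEigenvalue {l r : Boundary} {κ : ℝ≥0∞}
    (h : κ ≠ ⊤ → ∀ f, L.Admissible l r f → L.normSq f ≤ 4 * κ * L.energy f) :
    (4 * κ)⁻¹ ≤ L.leadingEigenvalue l r := by
  rcases eq_or_ne κ ⊤ with rfl | hκ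
  · simp
  · exact le_sSup fun f hf => inv_mul_le_of_le_mul (h hκ f hf)

theorem IsElliptic.inv_kappaDN_le (hL : L.IsElliptic) :
    (4 * L.kappaDN)⁻¹ ≤ L.leadingEigenvalue .dirichlet .neumann := by
  refine inv_le_leadingEigenvalue fun hκ f hf => ?_
  rw [normSq_eq, energy_eq, withDensity_apply _ measurableSet_E,
    energyMeasure_apply measurableSet_E]
  exact hL.hardy_left le_rfl le_rfl hκ (le_iSup₂_of_le · · le_rfl)
    fun x hx => hf.1.enorm_le_of_vanishesAtLo hf.2 hx

theorem IsElliptic.inv_kappaND_le (hL : L.IsElliptic) :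
    (4 * L.kappaND)⁻¹ ≤ L.leadingEigenvalue .neumann .dirichlet := by
  refine inv_le_leadingEigenvalue fun hκ f hf => ?_
  rw [normSq_eq, energy_eq, withDensity_apply _ measurableSet_E,
    energyMeasure_apply measurableSet_E]
  exact hL.hardy_right le_rfl le_rfl hκ (le_iSup₂_of_le · · le_rfl)
    fun x hx => hf.1.enorm_le_of_vanishesAtHi hf.2 hx

theorem IsElliptic.inv_kappaDD_le (hL : L.IsElliptic) :
    (4 * L.kappaDD)⁻¹ ≤ L.leadingEigenvalue .dirichlet .dirichlet := by
  refine inv_le_leadingEigenvalue fun hκ f hf => ?_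
  rw [normSq_eq, energy_eq]
  -- The measures compared are `f² dμ` and the energy measure, with factor `4κ`.
  refine measure_interval_le_of_forall_or hL.lt.le fun θ hθ => ?_
  simp only [withDensity_apply _ (measurableSet_interval _ _),
    energyMeasure_apply (measurableSet_interval _ _)]
  have key := forall_le_or_forall_le (m := L.scale) (n := L.speed) (κ := L.kappaDD) hκ
    (fun p q => hL.scale_ne_zero)
    (fun x hx y hy hxy => ENNReal.inv_le_inv.2 (iInf₂_le_of_le x hx
      (iInf₂_le_of_le y hy (iInf_le_of_le hxy.le le_rfl)))) hθ
  refine key.imp (fun h => ?_) (fun h => ?_)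
  · exact hL.hardy_left le_rfl hθ.2.le hκ h
      fun x hx => hf.1.enorm_le_of_vanishesAtLo hf.2.1 ⟨hx.1, hx.2.trans hθ.2⟩
  · exact hL.hardy_right hθ.1.le le_rfl hκ h
      fun x hx => hf.1.enorm_le_of_vanishesAtHi hf.2.2 ⟨hθ.1.trans hx.1, hx.2⟩

theorem aecover_interval_left :
    AECover L.speed (comap Real.toEReal (𝓝[<] L.hi)) fun θ => interval L.lo θ where
  ae_eventually_mem := by
    filter_upwards [show ∀ᵐ x ∂L.speed, x ∈ L.E from speed_compl_E] with x hx
    filter_upwards [eventually_mem_interval_right hx.2] with θ hθ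
    exact ⟨hx.1, hθ.1⟩
  measurableSet _ := measurableSet_interval _ _

theorem aecover_interval_right :
    AECover L.speed (comap Real.toEReal (𝓝[>] L.lo)) fun θ => interval θ L.hi where
  ae_eventually_mem := by
    filter_upwards [show ∀ᵐ x ∂L.speed, x ∈ L.E from speed_compl_E] with x hx
    filter_upwards [eventually_mem_interval_left hx.1] with θ hθ
    exact ⟨hθ.2, hx.2⟩
  measurableSet _ := measurableSet_interval _ _

/-- For a function with mean zero, a bound for second moments about varying centers, on sets that
exhaust the space, is a bound for the variance. -/
theorem lintegral_sq_le_of_aecover {m : Measure ℝ} [IsFiniteMeasure m] [NeZero m]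
    (hf : Integrable f m) (h0 : ∫ x, f x ∂m = 0) {ι : Type*} {l : Filter ι} [l.NeBot]
    [l.IsCountablyGenerated] {φ : ι → Set ℝ} (hφ : AECover m l φ) {K : ℝ≥0∞}
    (hK : ∀ᶠ i in l, ∃ c, ∫⁻ x in φ i, ENNReal.ofReal ((f x - c) ^ 2) ∂m ≤ K) :
    ∫⁻ x, ENNReal.ofReal (f x ^ 2) ∂m ≤ K := by
  have hm : m.real univ ≠ 0 := by
    rw [measureReal_def]
    exact (ENNReal.toReal_pos (by simpa using NeZero.ne m) (measure_ne_top _ _)).ne'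
  have h1 := hφ.lintegral_tendsto_of_countably_generated (f := fun x => ENNReal.ofReal (f x ^ 2))
    (hf.aestronglyMeasurable.aemeasurable.pow_const 2).ennreal_ofReal
  have h2 := hφ.integral_tendsto_of_countably_generated hf
  have h3 := hφ.integral_tendsto_of_countably_generated (integrable_const (1 : ℝ))
  simp only [integral_const, smul_eq_mul, mul_one, measureReal_restrict_apply_univ] at h3
  have h4 : Tendsto (fun i => K + ENNReal.ofReal ((∫ x in φ i, f x ∂m) ^ 2 / m.real (φ i))) l
      (𝓝 (K + ENNReal.ofReal (0 ^ 2 / m.real univ))) := by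
    rw [h0] at h2
    exact tendsto_const_nhds.add (ENNReal.tendsto_ofReal ((h2.pow 2).div h3 hm))
  rw [zero_pow two_ne_zero, zero_div, ENNReal.ofReal_zero, add_zero] at h4
  refine le_of_tendsto_of_tendsto h1 h4 ?_
  filter_upwards [hK] with i ⟨c, hc⟩
  refine (lintegral_sq_le_lintegral_sq_sub_add _ hf.restrict c).trans ?_
  rw [measureReal_restrict_apply_univ]
  gcongr

/-- `f - f θ` vanishes at `θ`, so Hardy's inequality runs from `θ` outwards and needs no condition
at the end of `E`. -/
theorem IsElliptic.lintegral_sq_sub_le_left (hL : L.IsElliptic) (hf : L.LocallyAC f) {κ : ℝ≥0∞}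
    (hκ : κ ≠ ⊤) {θ : ℝ} (hθ : θ ∈ L.E)
    (h : ∀ x ∈ interval L.lo θ, L.speed (interval L.lo x) * L.scale (interval x θ) ≤ κ) :
    ∫⁻ x in interval L.lo θ, ENNReal.ofReal ((f x - f θ) ^ 2) ∂L.speed
      ≤ 4 * κ * L.energyMeasure f (interval L.lo θ) := by
  simp only [← enorm_sq_eq_ofReal]
  rw [← energyMeasure_sub_const (f θ), energyMeasure_apply (measurableSet_interval _ _)]
  refine hL.hardy_right le_rfl hθ.2.le hκ h fun x hx => ?_
  rw [← enorm_neg, neg_sub, interval_coe]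
  simpa using hf.enorm_sub_le ⟨hx.1, hx.2.trans hθ.2⟩ hθ (EReal.coe_le_coe_iff.1 hx.2.le)

theorem IsElliptic.lintegral_sq_sub_le_right (hL : L.IsElliptic) (hf : L.LocallyAC f) {κ : ℝ≥0∞}
    (hκ : κ ≠ ⊤) {θ : ℝ} (hθ : θ ∈ L.E)
    (h : ∀ y ∈ interval θ L.hi, L.scale (interval θ y) * L.speed (interval y L.hi) ≤ κ) :
    ∫⁻ x in interval θ L.hi, ENNReal.ofReal ((f x - f θ) ^ 2) ∂L.speed
      ≤ 4 * κ * L.energyMeasure f (interval θ L.hi) := by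
  simp only [← enorm_sq_eq_ofReal]
  rw [← energyMeasure_sub_const (f θ), energyMeasure_apply (measurableSet_interval _ _)]
  refine hL.hardy_left hθ.1.le le_rfl hκ h fun y hy => ?_
  rw [interval_coe]
  simpa using hf.enorm_sub_le hθ ⟨hθ.1.trans hy.1, hy.2⟩ (EReal.coe_le_coe_iff.1 hy.1.le)

theorem IsElliptic.inv_kappaNN_le (hL : L.IsElliptic) (hfin : L.speed L.E < ⊤) :
    (4 * L.kappaNN)⁻¹ ≤ L.leadingEigenvalue .neumann .neumann := by
  refine inv_le_leadingEigenvalue fun hκ f hf => ?_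
  have hfm : IsFiniteMeasure L.speed := ⟨by
    rwa [← restrict_speed_E, Measure.restrict_apply_univ]⟩
  have hne : NeZero L.speed := ⟨fun h0 => hL.speed_ne_zero le_rfl le_rfl hL.lt (by simp [h0])⟩
  obtain ⟨hac, hint, hmean⟩ := hf
  rw [energy_eq]
  obtain ⟨c, hc, hc', hP, hQ⟩ := exists_split hL.lt.le fun θ hθ =>
    forall_le_or_forall_le (m := L.speed) (n := L.scale) (κ := L.kappaNN) hκ
      (fun p q => hL.speed_ne_zero)
      (fun x hx y hy hxy => ENNReal.inv_le_inv.2 (iInf₂_le_of_le x hx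
        (iInf₂_le_of_le y hy (iInf_le_of_le hxy le_rfl)))) hθ
  have hleft : ∀ θ ∈ L.E, (θ : EReal) ≤ c →
      ∫⁻ x in interval L.lo θ, ENNReal.ofReal ((f x - f θ) ^ 2) ∂L.speed
        ≤ 4 * L.kappaNN * L.energyMeasure f (interval L.lo θ) := by
    intro θ hθ hθc
    refine hL.lintegral_sq_sub_le_left hac hκ hθ fun x hx => ?_
    -- The left alternative is known only at some points close to `c`. Each `w < θ` lies below such
    -- a point, and the supremum over `w` yields the bound at `θ`, including `θ = c`.
    rw [measure_interval_eq_iSup_right L.scale]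
    simp only [ENNReal.mul_iSup]
    refine iSup₂_le fun w hw => ?_
    obtain ⟨θ', hθ', -, -, h⟩ := hP w ⟨hx.1.trans hw.1, hw.2.trans_le hθc⟩
    refine le_trans ?_ (h x ⟨hx.1, hw.1.trans hθ'.1⟩)
    gcongr
    exact interval_subset le_rfl hθ'.1.le
  have hright : ∀ θ ∈ L.E, c ≤ (θ : EReal) →
      ∫⁻ x in interval θ L.hi, ENNReal.ofReal ((f x - f θ) ^ 2) ∂L.speed
        ≤ 4 * L.kappaNN * L.energyMeasure f (interval θ L.hi) := by
    intro θ hθ hθc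
    refine hL.lintegral_sq_sub_le_right hac hκ hθ fun y hy => ?_
    rw [measure_interval_eq_iSup_left L.scale]
    simp only [ENNReal.iSup_mul]
    exact iSup₂_le fun z hz => hQ z ⟨hθc.trans_lt hz.1, hz.2.trans hy.2⟩ y ⟨hz.2, hy.2⟩
  have hlmono : ∀ θ ∈ L.E, 4 * L.kappaNN * L.energyMeasure f (interval L.lo θ)
      ≤ 4 * L.kappaNN * L.energyMeasure f L.E := fun θ hθ => by
    gcongr; exact interval_subset le_rfl hθ.2.le
  have hrmono : ∀ θ ∈ L.E, 4 * L.kappaNN * L.energyMeasure f (interval θ L.hi)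
      ≤ 4 * L.kappaNN * L.energyMeasure f L.E := fun θ hθ => by
    gcongr; exact interval_subset hθ.1.le le_rfl
  -- At an end of `E` there is no value `f c`: the centers `f θ` vary with the exhausting intervals.
  rcases hc'.eq_or_lt with rfl | hclt
  · have := comap_nhdsLT_neBot hL.lt
    refine lintegral_sq_le_of_aecover hint hmean aecover_interval_left ?_
    filter_upwards [eventually_mem_interval_right hL.lt] with θ hθ
    exact ⟨f θ, (hleft θ hθ hθ.2.le).trans (hlmono θ hθ)⟩
  rcases hc.eq_or_lt with rfl | hclt'
  · have := comap_nhdsGT_neBot hL.lt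
    refine lintegral_sq_le_of_aecover hint hmean aecover_interval_right ?_
    filter_upwards [eventually_mem_interval_left hL.lt] with θ hθ
    exact ⟨f θ, (hright θ hθ hθ.1.le).trans (hrmono θ hθ)⟩
  lift c to ℝ using ⟨(hclt.trans_le le_top).ne, (bot_le.trans_lt hclt').ne'⟩
  have hcE : c ∈ L.E := ⟨hclt', hclt⟩
  -- For an interior cut the exhaustion is constant: the whole line with the single center `f c`.
  refine lintegral_sq_le_of_aecover (l := pure ()) (φ := fun _ => univ) hint hmean
    ⟨by simp, by simp⟩ (Filter.Eventually.of_forall fun _ => ⟨f c, ?_⟩)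
  have := measure_interval_le_add
    (m := L.speed.withDensity fun x => ENNReal.ofReal ((f x - f c) ^ 2)) L.lo c L.hi
  simp only [withDensity_apply _ (measurableSet_interval _ _)] at this
  rw [Measure.restrict_univ, ← restrict_speed_E]
  refine this.trans ((add_le_add (hleft c hcE le_rfl) (hright c hcE le_rfl)).trans ?_)
  rw [← mul_add]
  gcongr
  exact add_measure_interval_le hclt'.le hclt.le

end Operator

end EllipticLine

/-! ### Upper bounds: test functions -/

namespace EllipticLine

namespace Operator

variable {L : Operator} {f : ℝ → ℝ}

/-- The function which is `0` on `(-∞, z]`, constant on `[x, ∞)`, and a primitive of `e^{-C}`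
in between. -/
noncomputable def ramp (L : Operator) (z x t : ℝ) : ℝ :=
  ∫ u in z..t, (Ioc z x).indicator (fun u => Real.exp (-L.C u)) u

/-- The total increase of `ramp`. -/
noncomputable def rise (L : Operator) (z x : ℝ) : ℝ := ∫ u in Ioc z x, Real.exp (-L.C u)

theorem ramp_of_le {z x t : ℝ} (h : t ≤ z) : L.ramp z x t = 0 := by
  rw [ramp, intervalIntegral.integral_of_ge h, setIntegral_indicator measurableSet_Ioc]
  have : Ioc t z ∩ Ioc z x = ∅ :=
    eq_empty_of_forall_notMem fun u hu => not_lt.2 hu.1.2 hu.2.1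
  simp [this]

theorem ramp_of_ge {z x t : ℝ} (hzx : z ≤ x) (h : x ≤ t) : L.ramp z x t = L.rise z x := by
  rw [ramp, intervalIntegral.integral_of_le (hzx.trans h), setIntegral_indicator measurableSet_Ioc,
    inter_eq_right.2 (Ioc_subset_Ioc_right h), rise]

theorem IsElliptic.integrable_indicator (hL : L.IsElliptic) {z x : ℝ} (hz : z ∈ L.E)
    (hx : x ∈ L.E) : Integrable ((Ioc z x).indicator fun u => Real.exp (-L.C u)) :=
  ((hL.integrableOn_exp_neg_C hz hx).mono_set Ioc_subset_Icc_self).integrable_indicator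
    measurableSet_Ioc

theorem IsElliptic.abs_ramp_le (hL : L.IsElliptic) {z x : ℝ} (hz : z ∈ L.E) (hx : x ∈ L.E)
    (t : ℝ) : |L.ramp z x t| ≤ L.rise z x := by
  have hi := hL.integrable_indicator hz hx
  calc |L.ramp z x t| ≤ ∫ u in uIoc z t, ‖(Ioc z x).indicator (fun u => Real.exp (-L.C u)) u‖ :=
        intervalIntegral.norm_integral_le_integral_norm_uIoc (μ := volume)
          (f := (Ioc z x).indicator fun u => Real.exp (-L.C u))
    _ ≤ ∫ u, ‖(Ioc z x).indicator (fun u => Real.exp (-L.C u)) u‖ :=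
        setIntegral_le_integral hi.norm (Eventually.of_forall fun _ => norm_nonneg _)
    _ = ∫ u, (Ioc z x).indicator (fun u => Real.exp (-L.C u)) u := by
        congr 1 with u
        exact Real.norm_of_nonneg (indicator_nonneg (fun _ _ => (Real.exp_pos _).le) u)
    _ = L.rise z x := by rw [integral_indicator measurableSet_Ioc, rise]

theorem IsElliptic.ofReal_rise (hL : L.IsElliptic) {z x : ℝ} (hz : z ∈ L.E) (hx : x ∈ L.E) :
    ENNReal.ofReal (L.rise z x) = L.scale (interval z x) := (hL.scale_coe hz hx).symm

theorem IsElliptic.rise_pos (hL : L.IsElliptic) {z x : ℝ} (hz : z ∈ L.E) (hx : x ∈ L.E)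
    (h : z < x) : 0 < L.rise z x := by
  have := hL.scale_ne_zero hz.1.le hx.2.le (EReal.coe_lt_coe_iff.2 h)
  rw [← hL.ofReal_rise hz hx] at this
  simpa using this

theorem IsElliptic.locallyAC_ramp (hL : L.IsElliptic) {z x : ℝ} (hz : z ∈ L.E)
    (hx : x ∈ L.E) : L.LocallyAC (L.ramp z x) :=
  locallyAC_integral hz fun _ _ _ _ => (hL.integrable_indicator hz hx).intervalIntegrable

theorem LocallyAC.affine {g : ℝ → ℝ} (hf : L.LocallyAC f) (hg : L.LocallyAC g) (c α β : ℝ) :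
    L.LocallyAC fun t => c + α * f t + β * g t := fun x hx y hy =>
  ((LipschitzWith.const c).lipschitzOnWith.absolutelyContinuousOnInterval.fun_add
    ((hf x hx y hy).const_mul α)).fun_add ((hg x hx y hy).const_mul β)

/-- On a slope, `(α e^{-C})² e^C = α² e^{-C}`, a multiple of the scale density. Since `x ≤ y` the
slopes are disjoint and there is no cross term. -/
theorem IsElliptic.energy_le (hL : L.IsElliptic) {z x y w : ℝ} (hz : z ∈ L.E) (hx : x ∈ L.E)
    (hy : y ∈ L.E) (hw : w ∈ L.E) (hxy : x ≤ y) (c α β : ℝ) :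
    L.energy (fun t => c + α * L.ramp z x t + β * L.ramp y w t) ≤
      ENNReal.ofReal (α ^ 2) * L.scale (interval z x)
        + ENNReal.ofReal (β ^ 2) * L.scale (interval y w) := by
  have hscale : ∀ {u v : ℝ}, u ∈ L.E → v ∈ L.E → ∀ γ : ℝ,
      ∫⁻ t in L.E, (Ioc u v).indicator (fun t => ENNReal.ofReal (γ ^ 2 * Real.exp (-L.C t))) t
        = ENNReal.ofReal (γ ^ 2) * L.scale (interval u v) := by
    intro u v hu hv γ
    have hsub : Ioc u v ⊆ L.E := Ioc_subset_Icc_self.trans (Icc_subset_interval hu hv)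
    simp only [ENNReal.ofReal_mul (sq_nonneg γ)]
    rw [setLIntegral_indicator measurableSet_Ioc, inter_eq_left.2 hsub,
      lintegral_const_mul' _ _ ENNReal.ofReal_ne_top, hL.scale_coe hu hv,
      ofReal_integral_eq_lintegral_ofReal
        ((hL.integrableOn_exp_neg_C hu hv).mono_set Ioc_subset_Icc_self)
        (Eventually.of_forall fun t => (Real.exp_pos _).le)]
  have hd1 := LocallyIntegrable.ae_hasDerivAt_integral (hL.integrable_indicator hz hx).locallyIntegrable
  have hd2 := LocallyIntegrable.ae_hasDerivAt_integral (hL.integrable_indicator hy hw).locallyIntegrable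
  have hm : AEMeasurable
      ((Ioc z x).indicator fun t => ENNReal.ofReal (α ^ 2 * Real.exp (-L.C t)))
      (volume.restrict L.E) :=
    ((Real.measurable_exp.comp_aemeasurable hL.aemeasurable_C.neg).const_mul _).ennreal_ofReal
      |>.indicator measurableSet_Ioc
  rw [energy, ← hscale hz hx, ← hscale hy hw, ← lintegral_add_left' hm]
  refine lintegral_mono_ae (ae_restrict_of_ae ?_)
  filter_upwards [hd1, hd2] with t h1 h2
  have hder : deriv (fun t => c + α * L.ramp z x t + β * L.ramp y w t) t =
      α * (Ioc z x).indicator (fun u => Real.exp (-L.C u)) t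
        + β * (Ioc y w).indicator (fun u => Real.exp (-L.C u)) t :=
    ((((h1 z).const_mul α).const_add c).add ((h2 y).const_mul β)).deriv
  have hee : Real.exp (-L.C t) * Real.exp (L.C t) = 1 := by rw [← Real.exp_add]; simp
  have hsq : ∀ γ : ℝ, (γ * Real.exp (-L.C t)) ^ 2 * Real.exp (L.C t)
      = γ ^ 2 * Real.exp (-L.C t) := fun γ => by
    linear_combination γ ^ 2 * Real.exp (-L.C t) * hee
  rw [hder]
  by_cases ht1 : t ∈ Ioc z x
  · have ht2 : t ∉ Ioc y w := fun h => not_lt.2 (ht1.2.trans hxy) h.1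
    simp [ht1, ht2, hsq]
  · by_cases ht2 : t ∈ Ioc y w
    · simp [ht1, ht2, hsq]
    · simp [ht1, ht2]

theorem le_normSq {J : Set ℝ} (hJ : MeasurableSet J) {v : ℝ} (h : ∀ t ∈ J, f t = v) :
    ENNReal.ofReal (v ^ 2) * L.speed J ≤ L.normSq f := by
  rw [← setLIntegral_const]
  refine (setLIntegral_mono' hJ fun t ht => ?_).trans (setLIntegral_le_lintegral J _)
  rw [h t ht]

theorem add_le_normSq {J J' : Set ℝ} (hJ : MeasurableSet J) (hJ' : MeasurableSet J')
    (hd : Disjoint J J') {v v' : ℝ} (h : ∀ t ∈ J, f t = v) (h' : ∀ t ∈ J', f t = v') :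
    ENNReal.ofReal (v ^ 2) * L.speed J + ENNReal.ofReal (v' ^ 2) * L.speed J' ≤ L.normSq f := by
  rw [← setLIntegral_const, ← setLIntegral_const]
  refine le_trans (add_le_add (setLIntegral_mono' hJ fun t ht => ?_)
    (setLIntegral_mono' hJ' fun t ht => ?_)) ((lintegral_union hJ' hd).symm.trans_le
      (setLIntegral_le_lintegral (J ∪ J') fun t => ENNReal.ofReal (f t ^ 2)))
  · rw [h t ht]
  · rw [h' t ht]

theorem vanishesAtLo_of_eq_zero {z : ℝ} (hz : z ∈ L.E) (h : ∀ t ≤ z, f t = 0) :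
    L.VanishesAtLo f := by
  refine tendsto_const_nhds.congr' ?_
  filter_upwards [eventually_mem_interval_left hz.1] with t ht
  exact (h t (EReal.coe_le_coe_iff.1 ht.2.le)).symm

theorem vanishesAtHi_of_eq_zero {w : ℝ} (hw : w ∈ L.E) (h : ∀ t, w ≤ t → f t = 0) :
    L.VanishesAtHi f := by
  refine tendsto_const_nhds.congr' ?_
  filter_upwards [eventually_mem_interval_right hw.2] with t ht
  exact (h t (EReal.coe_le_coe_iff.1 ht.1.le)).symm

theorem IsElliptic.ofReal_inv_rise_sq_mul (hL : L.IsElliptic) {z x : ℝ} (hz : z ∈ L.E)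
    (hx : x ∈ L.E) (h : z < x) :
    ENNReal.ofReal ((L.rise z x)⁻¹ ^ 2) * L.scale (interval z x) = (L.scale (interval z x))⁻¹ := by
  have hR := hL.rise_pos hz hx h
  rw [← hL.ofReal_rise hz hx, ← ENNReal.ofReal_mul (sq_nonneg _), ← ENNReal.ofReal_inv_of_pos hR]
  congr 1
  field_simp

section upper

variable {lam : ℝ≥0∞} {l r : Boundary}

theorem IsElliptic.mul_speed_le_DN (hL : L.IsElliptic)
    (h : ∀ f : ℝ → ℝ, L.Admissible .dirichlet .neumann f → lam * L.normSq f ≤ L.energy f)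
    {z x : ℝ} (hz : z ∈ L.E) (hx : x ∈ L.E) (hzx : z < x) :
    lam * L.speed (interval x L.hi) ≤ (L.scale (interval z x))⁻¹ := by
  have hR := hL.rise_pos hz hx hzx
  -- The second ramp is a dummy, present to match the form of `energy_le`.
  set F : ℝ → ℝ := fun t => 0 + (L.rise z x)⁻¹ * L.ramp z x t + 0 * L.ramp x x t with hF
  have hadm : L.Admissible .dirichlet .neumann F :=
    ⟨(hL.locallyAC_ramp hz hx).affine (hL.locallyAC_ramp hx hx) _ _ _,
      vanishesAtLo_of_eq_zero hz fun t ht => by simp [hF, ramp_of_le ht]⟩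
  have h1 := le_normSq (L := L) (f := F) (v := 1) (measurableSet_interval x L.hi) fun t ht => by
    simp [hF, ramp_of_ge hzx.le (EReal.coe_le_coe_iff.1 ht.1.le), hR.ne']
  have h2 := hL.energy_le hz hx hx hx le_rfl 0 (L.rise z x)⁻¹ 0
  rw [hL.ofReal_inv_rise_sq_mul hz hx hzx] at h2
  calc lam * L.speed (interval x L.hi) ≤ lam * L.normSq F := by gcongr; simpa using h1
    _ ≤ L.energy F := h F hadm
    _ ≤ _ := h2.trans (by simp)

theorem IsElliptic.mul_speed_le_ND (hL : L.IsElliptic)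
    (h : ∀ f : ℝ → ℝ, L.Admissible .neumann .dirichlet f → lam * L.normSq f ≤ L.energy f)
    {y w : ℝ} (hy : y ∈ L.E) (hw : w ∈ L.E) (hyw : y < w) :
    lam * L.speed (interval L.lo y) ≤ (L.scale (interval y w))⁻¹ := by
  have hR := hL.rise_pos hy hw hyw
  set F : ℝ → ℝ := fun t => 1 + 0 * L.ramp y y t + (-(L.rise y w)⁻¹) * L.ramp y w t with hF
  have hadm : L.Admissible .neumann .dirichlet F :=
    ⟨(hL.locallyAC_ramp hy hy).affine (hL.locallyAC_ramp hy hw) _ _ _,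
      vanishesAtHi_of_eq_zero hw fun t ht => by simp [hF, ramp_of_ge hyw.le ht, hR.ne']⟩
  have h1 := le_normSq (L := L) (f := F) (v := 1) (measurableSet_interval L.lo y) fun t ht => by
    simp [hF, ramp_of_le (EReal.coe_le_coe_iff.1 ht.2.le)]
  have h2 := hL.energy_le hy hy hy hw le_rfl 1 0 (-(L.rise y w)⁻¹)
  rw [neg_sq, hL.ofReal_inv_rise_sq_mul hy hw hyw] at h2
  calc lam * L.speed (interval L.lo y) ≤ lam * L.normSq F := by gcongr; simpa using h1
    _ ≤ L.energy F := h F hadm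
    _ ≤ _ := h2.trans (by simp)

theorem IsElliptic.mul_speed_le_DD (hL : L.IsElliptic)
    (h : ∀ f : ℝ → ℝ, L.Admissible .dirichlet .dirichlet f → lam * L.normSq f ≤ L.energy f)
    {z x y w : ℝ} (hz : z ∈ L.E) (hx : x ∈ L.E) (hy : y ∈ L.E) (hw : w ∈ L.E) (hzx : z < x)
    (hxy : x ≤ y) (hyw : y < w) :
    lam * L.speed (interval x y) ≤ (L.scale (interval z x))⁻¹ + (L.scale (interval y w))⁻¹ := by
  have hR := hL.rise_pos hz hx hzx
  have hR' := hL.rise_pos hy hw hyw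
  -- A trapezoid: 0 up to `z`, 1 on `[x, y]`, 0 from `w` on.
  set F : ℝ → ℝ := fun t =>
    0 + (L.rise z x)⁻¹ * L.ramp z x t + (-(L.rise y w)⁻¹) * L.ramp y w t with hF
  have hadm : L.Admissible .dirichlet .dirichlet F :=
    ⟨(hL.locallyAC_ramp hz hx).affine (hL.locallyAC_ramp hy hw) _ _ _,
      vanishesAtLo_of_eq_zero hz fun t ht => by
        simp [hF, ramp_of_le ht, ramp_of_le (ht.trans (hzx.le.trans hxy))],
      vanishesAtHi_of_eq_zero hw fun t ht => by
        simp [hF, ramp_of_ge hyw.le ht, ramp_of_ge hzx.le (hxy.trans (hyw.le.trans ht)), hR.ne',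
          hR'.ne']⟩
  have h1 := le_normSq (L := L) (f := F) (v := 1) (measurableSet_interval x y) fun t ht => by
    simp [hF, ramp_of_le (EReal.coe_le_coe_iff.1 ht.2.le),
      ramp_of_ge hzx.le (EReal.coe_le_coe_iff.1 ht.1.le), hR.ne']
  have h2 := hL.energy_le hz hx hy hw hxy 0 (L.rise z x)⁻¹ (-(L.rise y w)⁻¹)
  rw [neg_sq, hL.ofReal_inv_rise_sq_mul hy hw hyw, hL.ofReal_inv_rise_sq_mul hz hx hzx] at h2
  calc lam * L.speed (interval x y) ≤ lam * L.normSq F := by gcongr; simpa using h1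
    _ ≤ L.energy F := h F hadm
    _ ≤ _ := h2

/-- The left side is `ab / (a + b)`, the minimum of the right side over `u`, attained at `u = b / (a
+ b)`. -/
theorem inv_inv_add_inv_le {a b : ℝ≥0∞} (ha : a ≠ 0) (hb : b ≠ 0) (ha' : a ≠ ⊤) (hb' : b ≠ ⊤)
    (u : ℝ) :
    (a⁻¹ + b⁻¹)⁻¹ ≤ ENNReal.ofReal (u ^ 2) * a + ENNReal.ofReal ((1 - u) ^ 2) * b := by
  have hap := ENNReal.toReal_pos ha ha'
  have hbp := ENNReal.toReal_pos hb hb'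
  rw [← ENNReal.ofReal_toReal ha', ← ENNReal.ofReal_toReal hb', ← ENNReal.ofReal_inv_of_pos hap,
    ← ENNReal.ofReal_inv_of_pos hbp, ← ENNReal.ofReal_add (by positivity) (by positivity),
    ← ENNReal.ofReal_inv_of_pos (by positivity), ← ENNReal.ofReal_mul (sq_nonneg _),
    ← ENNReal.ofReal_mul (sq_nonneg _), ← ENNReal.ofReal_add (by positivity) (by positivity)]
  refine ENNReal.ofReal_le_ofReal ?_
  generalize a.toReal = a at *
  generalize b.toReal = b at *
  have e : (a⁻¹ + b⁻¹)⁻¹ = a * b / (a + b) := by field_simp; ring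
  rw [e, div_le_iff₀ (by positivity)]
  nlinarith [sq_nonneg (u * a - (1 - u) * b)]

theorem IsElliptic.mul_le_NN (hL : L.IsElliptic) (hfin : L.speed L.E < ⊤)
    (h : ∀ f : ℝ → ℝ, L.Admissible .neumann .neumann f → lam * L.normSq f ≤ L.energy f)
    {x y : ℝ} (hx : x ∈ L.E) (hy : y ∈ L.E) (hxy : x < y) :
    lam * ((L.speed (interval L.lo x))⁻¹ + (L.speed (interval y L.hi))⁻¹)⁻¹
      ≤ (L.scale (interval x y))⁻¹ := by
  have hR := hL.rise_pos hx hy hxy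
  have hfm : IsFiniteMeasure L.speed := ⟨by
    rwa [← restrict_speed_E, Measure.restrict_apply_univ]⟩
  have hpos : L.speed.real univ ≠ 0 := by
    rw [measureReal_def, ← restrict_speed_E, Measure.restrict_apply_univ]
    exact (ENNReal.toReal_pos (hL.speed_ne_zero le_rfl le_rfl hL.lt) hfin.ne).ne'
  have hac := hL.locallyAC_ramp hx hy
  have hint : Integrable (L.ramp x y) L.speed :=
    Integrable.of_bound
      (hac.aemeasurable.mono_ac (withDensity_absolutelyContinuous _ _)).aestronglyMeasurable
      (L.rise x y) (Eventually.of_forall fun t => hL.abs_ramp_le hx hy t)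
  -- The mean of the normalized ramp. After subtraction the plateaus have values `-u` and `1 - u`;
  -- the value of `u` is irrelevant, as the norm bound is minimized over it.
  set u : ℝ := (L.rise x y)⁻¹ * (∫ t, L.ramp x y t ∂L.speed) / L.speed.real univ with hu
  set F : ℝ → ℝ := fun t => -u + (L.rise x y)⁻¹ * L.ramp x y t + 0 * L.ramp y y t with hF
  have hF' : F = fun t => -u + (L.rise x y)⁻¹ * L.ramp x y t := by ext t; simp [hF]
  have hadm : L.Admissible .neumann .neumann F := by
    refine ⟨hac.affine (hL.locallyAC_ramp hy hy) _ _ _, ?_, ?_⟩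
    · rw [hF']; exact (integrable_const _).add (hint.const_mul _)
    · rw [hF', integral_add (integrable_const _) (hint.const_mul _), integral_const,
        integral_const_mul, smul_eq_mul, hu]
      field_simp
      ring
  have h1 := add_le_normSq (L := L) (f := F) (v := -u) (v' := 1 - u)
    (measurableSet_interval L.lo x) (measurableSet_interval y L.hi)
    (Set.disjoint_left.2 fun t ht ht' =>
      lt_asymm (ht.2.trans (EReal.coe_lt_coe_iff.2 hxy)) ht'.1)
    (fun t ht => by simp [hF, ramp_of_le (EReal.coe_le_coe_iff.1 ht.2.le)])
    (fun t ht => by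
      simp only [hF, ramp_of_ge hxy.le (EReal.coe_le_coe_iff.1 ht.1.le)]
      field_simp
      ring)
  have h2 := hL.energy_le hx hy hy hy le_rfl (-u) (L.rise x y)⁻¹ 0
  rw [hL.ofReal_inv_rise_sq_mul hx hy hxy] at h2
  rw [neg_sq] at h1
  calc _ ≤ lam * L.normSq F := by
        gcongr
        exact (inv_inv_add_inv_le (hL.speed_ne_zero le_rfl hx.2.le hx.1)
          (hL.speed_ne_zero hy.1.le le_rfl hy.2) (measure_ne_top _ _) (measure_ne_top _ _) u).trans h1
    _ ≤ L.energy F := h F hadm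
    _ ≤ _ := h2.trans (by simp)

end upper

theorem IsElliptic.le_inv_kappaDN (hL : L.IsElliptic) :
    L.leadingEigenvalue .dirichlet .neumann ≤ L.kappaDN⁻¹ := by
  refine sSup_le fun lam h => ENNReal.le_inv_iff_mul_le.2 ?_
  simp only [kappaDN, ENNReal.mul_iSup]
  refine iSup₂_le fun x hx => ?_
  -- The test function must vanish near the Dirichlet end, so its slope starts at an interior `z`;
  -- the supremum over `z` recovers `ν̂(lo,x)`, even if infinite.
  rw [measure_interval_eq_iSup_left]
  simp only [ENNReal.iSup_mul, ENNReal.mul_iSup]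
  refine iSup₂_le fun z hz => ?_
  have hzx : z < x := EReal.coe_lt_coe_iff.1 hz.2
  rw [mul_left_comm]
  exact (mul_le_mul_right (hL.mul_speed_le_DN h ⟨hz.1, hz.2.trans hx.2⟩ hx hzx) _).trans
    (ENNReal.mul_inv_le_one _)

theorem IsElliptic.le_inv_kappaND (hL : L.IsElliptic) :
    L.leadingEigenvalue .neumann .dirichlet ≤ L.kappaND⁻¹ := by
  refine sSup_le fun lam h => ENNReal.le_inv_iff_mul_le.2 ?_
  simp only [kappaND, ENNReal.mul_iSup]
  refine iSup₂_le fun x hx => ?_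
  rw [measure_interval_eq_iSup_right L.scale]
  simp only [ENNReal.mul_iSup]
  refine iSup₂_le fun w hw => ?_
  have hxw : x < w := EReal.coe_lt_coe_iff.1 hw.1
  rw [← mul_assoc]
  exact (mul_le_mul_left (hL.mul_speed_le_ND h hx ⟨hx.1.trans hw.1, hw.2⟩ hxw) _).trans
    (ENNReal.inv_mul_le_one _)

theorem IsElliptic.le_inv_kappaDD (hL : L.IsElliptic) :
    L.leadingEigenvalue .dirichlet .dirichlet ≤ L.kappaDD⁻¹ := by
  refine sSup_le fun lam h => ?_
  have H : ∀ x ∈ L.E, ∀ y ∈ L.E, x ≤ y → lam * L.speed (interval x y) ≤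
      (L.scale (interval L.lo x))⁻¹ + (L.scale (interval y L.hi))⁻¹ := by
    intro x hx y hy hxy
    rw [measure_interval_eq_iSup_left L.scale L.lo, measure_interval_eq_iSup_right L.scale y]
    simp only [ENNReal.inv_iSup, ENNReal.iInf_add, ENNReal.add_iInf]
    refine le_iInf₂ fun w hw => le_iInf₂ fun z hz => ?_
    exact hL.mul_speed_le_DD h ⟨hz.1, hz.2.trans hx.2⟩ hx hy ⟨hy.1.trans hw.1, hw.2⟩
      (EReal.coe_lt_coe_iff.1 hz.2) hxy (EReal.coe_lt_coe_iff.1 hw.1)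
  rw [kappaDD, inv_inv]
  refine le_iInf₂ fun x hx => le_iInf₂ fun y hy => le_iInf fun hxy => ?_
  -- For `x = y` the speed factor has inverse `⊤`, so the product is `⊤` unless the scale is
  -- infinite on both sides. Then it is `0 * ⊤ = 0`, and `lam = 0` has to be shown: moving `y` to
  -- the right keeps the scale beyond it infinite, and `H` gives `lam * μ(x,y) ≤ 0`.
  rcases hxy.eq_or_lt with rfl | hlt
  · rw [speed_coe_self, ENNReal.inv_zero]
    rcases eq_or_ne ((L.scale (interval L.lo x))⁻¹ + (L.scale (interval x L.hi))⁻¹) 0 with h0 | h0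
    · obtain ⟨y, hxy, hyhi⟩ := EReal.lt_iff_exists_real_btwn.1 hx.2
      have hy : y ∈ L.E := ⟨hx.1.trans hxy, hyhi⟩
      have hxy' : x < y := EReal.coe_lt_coe_iff.1 hxy
      rw [add_eq_zero, ENNReal.inv_eq_zero, ENNReal.inv_eq_zero] at h0
      have hytop : L.scale (interval y L.hi) = ⊤ := by
        have := measure_interval_le_add (m := L.scale) x y L.hi
        rw [h0.2, top_le_iff, ENNReal.add_eq_top] at this
        exact this.resolve_left (hL.scale_coe_ne_top hx hy)
      have := H x hx y hy hxy'.le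
      rw [h0.1, hytop, ENNReal.inv_top, add_zero, le_zero_iff, mul_eq_zero] at this
      rw [this.resolve_right (hL.speed_ne_zero hx.1.le hyhi.le hxy)]
      exact zero_le
    · rw [ENNReal.mul_top h0]
      exact le_top
  · rw [← div_eq_mul_inv, ENNReal.le_div_iff_mul_le
      (Or.inl (hL.speed_ne_zero hx.1.le hy.2.le (EReal.coe_lt_coe_iff.2 hlt)))
      (Or.inl (hL.speed_coe_ne_top hx hy))]
    exact H x hx y hy hxy

theorem IsElliptic.le_inv_kappaNN (hL : L.IsElliptic) (hfin : L.speed L.E < ⊤) :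
    L.leadingEigenvalue .neumann .neumann ≤ L.kappaNN⁻¹ := by
  refine sSup_le fun lam h => ?_
  rw [kappaNN, inv_inv]
  refine le_iInf₂ fun x hx => le_iInf₂ fun y hy => le_iInf fun hxy => ?_
  have hle := hL.mul_le_NN hfin h hx hy hxy
  have hsub : ∀ {p q : EReal}, L.lo ≤ p → q ≤ L.hi → L.speed (interval p q) ≠ ⊤ := fun hp hq =>
    ne_top_of_le_ne_top hfin.ne (measure_mono (interval_subset hp hq))
  set A := (L.speed (interval L.lo x))⁻¹ + (L.speed (interval y L.hi))⁻¹ with hA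
  have hA0 : A ≠ 0 := by simp [hA, hsub le_rfl hx.2.le]
  have hAtop : A ≠ ⊤ := by
    simp [hA, hL.speed_ne_zero le_rfl hx.2.le hx.1, hL.speed_ne_zero hy.1.le le_rfl hy.2]
  rwa [← div_eq_mul_inv lam, ENNReal.div_le_iff_le_mul (Or.inl hA0) (Or.inl hAtop), mul_comm] at hle

theorem pos_iff_lt_top_of_bounds {κ lam : ℝ≥0∞} (h1 : (4 * κ)⁻¹ ≤ lam) (h2 : lam ≤ κ⁻¹) :
    (4 * κ)⁻¹ ≤ lam ∧ lam ≤ κ⁻¹ ∧ (0 < lam ↔ κ < ⊤) := by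
  refine ⟨h1, h2, fun h => ?_, fun h => lt_of_lt_of_le ?_ h1⟩
  · exact lt_top_iff_ne_top.2 (ENNReal.inv_ne_zero.1 (h.trans_le h2).ne')
  · exact ENNReal.inv_pos.2 (ENNReal.mul_ne_top (by norm_num) h.ne)

end Operator

end EllipticLine

theorem mainTheorem1 (L : EllipticLine.Operator) (hL : L.IsElliptic)
    (l r : EllipticLine.Boundary)
    (hNN : l = EllipticLine.Boundary.neumann → r = EllipticLine.Boundary.neumann →
      L.speed L.E < ⊤) :
    (4 * L.kappa l r)⁻¹ ≤ L.leadingEigenvalue l r ∧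
    L.leadingEigenvalue l r ≤ (L.kappa l r)⁻¹ ∧
    (0 < L.leadingEigenvalue l r ↔ L.kappa l r < ⊤) := by
  apply EllipticLine.Operator.pos_iff_lt_top_of_bounds
  · cases l <;> cases r
    exacts [hL.inv_kappaDD_le, hL.inv_kappaDN_le, hL.inv_kappaND_le,
      hL.inv_kappaNN_le (hNN rfl rfl)]
  · cases l <;> cases r
    exacts [hL.le_inv_kappaDD, hL.le_inv_kappaDN, hL.le_inv_kappaND,
      hL.le_inv_kappaNN (hNN rfl rfl)]
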